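/- Let $N,M\ge 1$ be integers, let $\mathbb F_q$ be a finite field with $q$ elements, let $H$ be an $(N+M)$-dimensional vector space over $\mathbb F_q$, and let $h\subseteq H$ be a subspace of dimension $M$. Let $P$ be the poset (ordered by inclusion) of all subspaces $x$ of $H$ with $x\cap h=0$; let $\mathbb{C}P$ be the complex vector space with basis $P$, acted on by $\mathrm{Mat}_P(\mathbb C)$. Define $L,R\in \mathrm{Mat}_P(\mathbb C)$ by $L_{xy}=1$ if $y$ covers $x$ and $L_{xy}=0$ otherwise, and $R=L^t$. For $0\le i\le N$ let $F_i$ be the diagonal matrix with $(F_i)_{yy}=1$ if $\dim y=i$ and $(F_i)_{yy}=0$ otherwise, and let $K=\sum_{i=0}^N q^{N+M-i}F_i$. Let $T$ be the subalgebra of $\mathrm{Mat}_P(\mathbb C)$ generated by $R,L,K,K^{-1}$, and $Z(T)$ its center. For an irreducible $T$-submodule $W$ of $\mathbb{C}P$, the endpoint of $W$ is $r=\min\{i : 0\le i\le N,\ F_iW\ne 0\}$, its diameter is $d=|\{i: 0\le i\le N,\ F_iW\neq 0\}|-1$, and its type is $(r,d)$. Let $\Psi$ be the set of types that occur. For $\lambda\in\Psi$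 let $V_\lambda$ be the span of all irreducible $T$-submodules of $\mathbb{C}P$ of type $\lambda$, and let $e_\lambda$ be the projection of $\mathbb{C}P=\bigoplus_{\mu\in\Psi} V_\mu$ onto $V_\lambda$. Fix a complex square root $q^{1/2}$ of $q$ and put $$\Phi=\sum_{(r,d)\in\Psi} q^{r}e_{(r,d)},\qquad \Omega=\sum_{(r,d)\in\Psi} q^{d/2}e_{(r,d)}.$$ Then $\Phi$ and $\Omega$ belong to $Z(T)$ and act on every irreducible $T$-submodule of $\mathbb{C}P$ of type $(r,d)$ as the scalars $q^r$ and $q^{d/2}$, respectively. Let $\tau=q^{1/2}$ and let $U_\tau(\mathfrak{sl}_2)$ be the $\mathbb C$-algebra with generators $e,f,k^{\pm1}$ and relations $$kk^{-1}=k^{-1}k=1,\qquad ke=\tau^2ek,\qquad kf=\tau^{-2}fk,\qquad ef-fe=\frac{k-k^{-1}}{\tau-\tau^{-1}}.$$ Let $\Theta$ be any invertible element of $Z(T)$. Then the vector space $\mathbb{C}P$ becomes a $U_\tau(\mathfrak{sl}_2)$-module on which $e,f,k$ act as $$e\mapsto \Theta L,\qquad f\mapsto q^{-N-M+\frac12}\,\Theta^{-1}\Phi\Omega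 R,\qquad k\mapsto q^{-N-M}\,\Phi\Omega K .$$ -/

import Mathlib

noncomputable section

/-! ### The attenuated space poset -/

/-- The attenuated space poset: the subspaces of `H` that meet `h` trivially, ordered by
inclusion. (In the notation `𝒜_q(N, M)`: `q = |F|`, `dim H = N + M`, `dim h = M`.) -/
def AttenuatedSpace {F H : Type*} [Field F] [AddCommGroup H] [Module F H]
    (h : Submodule F H) : Type _ :=
  {x : Submodule F H // x ⊓ h = ⊥}

namespace AttenuatedSpace

section

variable {F H : Type*} [Field F] [AddCommGroup H] [Module F H] (h : Submodule F H)

instance : PartialOrder (AttenuatedSpace h) :=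
  inferInstanceAs (PartialOrder {x : Submodule F H // x ⊓ h = ⊥})

instance : DecidableEq (AttenuatedSpace h) := Classical.decEq _

variable [Finite F] [Module.Finite F H]

instance : Finite (AttenuatedSpace h) :=
  haveI : Finite H := Module.finite_of_finite F
  inferInstanceAs (Finite {x : Submodule F H // x ⊓ h = ⊥})

instance : Fintype (AttenuatedSpace h) := Fintype.ofFinite _

/-- The dimension of an element of the poset. -/
def rank {h : Submodule F H} (x : AttenuatedSpace h) : ℕ := Module.finrank F x.1

/-- `Mat_P(ℂ)`. -/
abbrev Mat : Type _ := Matrix (AttenuatedSpace h) (AttenuatedSpace h) ℂ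

/-- `ℂP`: formal linear combinations of the elements of the (finite) poset `P`, as coefficient
vectors. `Mat h` acts on it by `A • v = A *ᵥ v`. -/
abbrev CP : Type _ := AttenuatedSpace h → ℂ

open Classical in
/-- The lowering matrix. -/
def lowering : Mat h := Matrix.of fun x y => if x ⋖ y then 1 else 0

open Classical in
/-- The raising matrix. -/
def raising : Mat h := Matrix.of fun x y => if y ⋖ x then 1 else 0

/-- The `i`th projection matrix `F_i`. -/
def proj (i : ℕ) : Mat h := Matrix.diagonal fun y => if y.rank = i then 1 else 0

/-- `K = ∑_{i=0}^{N} q^{N+M-i} F_i`. -/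
def diagK (N M : ℕ) : Mat h :=
  ∑ i ∈ Finset.range (N + 1), ((Nat.card F : ℂ) ^ (N + M - i)) • proj h i

/-- The incidence algebra `T`, generated by `R`, `L`, `K`, `K⁻¹`. -/
def incAlg (N M : ℕ) : Subalgebra ℂ (Mat h) :=
  Algebra.adjoin ℂ {raising h, lowering h, diagK h N M, (diagK h N M)⁻¹}

/-! ### Irreducible modules and their types -/

variable {h}

/-- The set of `i` with `0 ≤ i ≤ N` and `F_i W ≠ 0`. -/
def support {N M : ℕ} (W : Submodule (incAlg h N M) (CP h)) : Set ℕ :=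
  {i | i ≤ N ∧ ∃ w ∈ W, proj h i • w ≠ 0}

/-- The endpoint of a `T`-module. -/
def endpoint {N M : ℕ} (W : Submodule (incAlg h N M) (CP h)) : ℕ := sInf (support W)

/-- The diameter of a `T`-module. -/
def diameter {N M : ℕ} (W : Submodule (incAlg h N M) (CP h)) : ℕ := (support W).ncard - 1

/-- `W` is an irreducible `T`-module with endpoint `r` and diameter `d`, where `t = (r, d)`. -/
def IsIrredOfType {N M : ℕ} (W : Submodule (incAlg h N M) (CP h)) (t : ℕ × ℕ) : Prop :=
  IsSimpleModule (incAlg h N M) W ∧ endpoint W = t.1 ∧ diameter W = t.2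

variable (h)

open Classical in
/-- The set `Ψ` of types `(r, d)` of irreducible `T`-modules. -/
def types (N M : ℕ) : Finset (ℕ × ℕ) :=
  (Finset.range (N + 1) ×ˢ Finset.range (N + 1)).filter
    fun t => ∃ W : Submodule (incAlg h N M) (CP h), IsIrredOfType W t

/-- `V_λ`: the subspace of `ℂP` spanned by the irreducible `T`-modules of type `λ = t`. -/
def homComponent (N M : ℕ) (t : ℕ × ℕ) : Submodule ℂ (CP h) :=
  Submodule.span ℂ {v | ∃ W : Submodule (incAlg h N M) (CP h), IsIrredOfType W t ∧ v ∈ W}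

/-- The span of all `V_μ` with `μ ∈ Ψ`, `μ ≠ λ`, where `λ = t`. -/
def homComponentCompl (N M : ℕ) (t : ℕ × ℕ) : Submodule ℂ (CP h) :=
  ⨆ s ∈ (types h N M).erase t, homComponent h N M s

open Classical in
/-- The matrix `e_λ` of the linear map that is the identity on `V_λ` and zero on `V_μ` for
all `μ ∈ Ψ`, `μ ≠ λ`. (That `ℂP` is the direct sum of the `V_μ` is a fact about `T`; the second
branch only serves to make the definition total.) -/
def centralIdem (N M : ℕ) (t : ℕ × ℕ) : Mat h :=
  if hc : IsCompl (homComponent h N M t) (homComponentCompl h N M t) then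
    LinearMap.toMatrix' (Submodule.projection _ _ hc)
  else 0

/-- `Φ = ∑_{(r,d) ∈ Ψ} q^r e_{(r,d)}`. -/
def Phi (N M : ℕ) : Mat h :=
  ∑ t ∈ types h N M, ((Nat.card F : ℂ) ^ t.1) • centralIdem h N M t

/-- `Ω = ∑_{(r,d) ∈ Ψ} q^{d/2} e_{(r,d)}`, where `τ` is the chosen square root of `q`. -/
def Omega (N M : ℕ) (τ : ℂ) : Mat h :=
  ∑ t ∈ types h N M, (τ ^ t.2) • centralIdem h N M t

end

end AttenuatedSpace

/-! ### The quantum group `U_τ(sl₂)` -/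

/-- Names of the Chevalley generators `e`, `f`, `k`, `k⁻¹`. -/
inductive UqSl2Gen : Type
  | e | f | k | kInv

open UqSl2Gen in
/-- The defining relations of `U_τ(sl₂)`. -/
inductive UqSl2Rel (τ : ℂ) : FreeAlgebra ℂ UqSl2Gen → FreeAlgebra ℂ UqSl2Gen → Prop
  | k_kInv : UqSl2Rel τ (FreeAlgebra.ι ℂ k * FreeAlgebra.ι ℂ kInv) 1
  | kInv_k : UqSl2Rel τ (FreeAlgebra.ι ℂ kInv * FreeAlgebra.ι ℂ k) 1
  | k_e : UqSl2Rel τ (FreeAlgebra.ι ℂ k * FreeAlgebra.ι ℂ e)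
      (τ ^ 2 • (FreeAlgebra.ι ℂ e * FreeAlgebra.ι ℂ k))
  | k_f : UqSl2Rel τ (FreeAlgebra.ι ℂ k * FreeAlgebra.ι ℂ f)
      ((τ ^ 2)⁻¹ • (FreeAlgebra.ι ℂ f * FreeAlgebra.ι ℂ k))
  | e_f : UqSl2Rel τ
      (FreeAlgebra.ι ℂ e * FreeAlgebra.ι ℂ f - FreeAlgebra.ι ℂ f * FreeAlgebra.ι ℂ e)
      ((τ - τ⁻¹)⁻¹ • (FreeAlgebra.ι ℂ k - FreeAlgebra.ι ℂ kInv))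

/-- The quantum enveloping algebra `U_τ(sl₂)` over `ℂ`, by generators and relations. -/
def UqSl2 (τ : ℂ) : Type := RingQuot (UqSl2Rel τ)

namespace UqSl2

instance (τ : ℂ) : Ring (UqSl2 τ) := inferInstanceAs (Ring (RingQuot (UqSl2Rel τ)))

instance (τ : ℂ) : Algebra ℂ (UqSl2 τ) := inferInstanceAs (Algebra ℂ (RingQuot (UqSl2Rel τ)))

/-- The generators of `U_τ(sl₂)`. -/
def gen (τ : ℂ) (g : UqSl2Gen) : UqSl2 τ :=
  RingQuot.mkAlgHom ℂ (UqSl2Rel τ) (FreeAlgebra.ι ℂ g)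

end UqSl2

end

/-!
Write `q = |F|`, and let `L`, `R`, `K` be the lowering, raising and diagonal matrices that
generate `T`. For `u ∈ h` and a functional `φ` on `H` that vanishes on `h`, the shear
`v ↦ v + φ(v) u` is an automorphism of `H` that fixes `h` pointwise, so it permutes the poset, and
its permutation matrix commutes with `L`, `R` and `K`. Let `S` be the sum of these matrices over all
pairs `(u, φ)`. The combinatorial core of the argument is the identity (`commutator_mul_diagK`)

  `(q - 1)(LR - RL) K = K² - q^M S`,

checked entry by entry: off the diagonal both sides are supported on the pairs `x`, `y` which have a
common coatom but whose sum meets `h`, and on the diagonal one counts covers and coatoms.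

It follows that `C = q^M S` lies in the center of `T`, and then so does the Casimir matrix
`(q - 1)² RL + q K + C K⁻¹`. Let `W` be a simple `T`-module of type `(r, d)` and let `κ_i` be the
eigenvalue `q^(N + M - i)` of `K` on rank `i`. The support of `W` has no gaps, so it is the interval
from `r` to `r + d`. Evaluating the Casimir matrix on a lowest and on a highest vector of `W` gives
two expressions for one scalar, which force `C = κ_r κ_{r+d}` and show that the Casimir scalar is
`q κ_r + κ_{r+d}` (`central_scalars`). These two scalars determine `(r, d)`, so the idempotents
`e_λ` are polynomials in `C` and the Casimir matrix, and therefore central elements of `T`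
(`exists_centerVal_eq_centralIdem`). As `T` is closed under conjugate transposition, `ℂP` is
semisimple, and an identity between elements of `T` can be checked on simple modules.

In particular `C = q^(2(N + M)) (Φ Ω)⁻²`. Substituting this in the commutator identity turns it into
the relation between `e` and `f` in `U_τ(sl₂)` (`UqSl2.exists_lift_of_central`), and the other
relations only express how `K` commutes with `L` and `R`.
-/

namespace AttenuatedSpace

/-! ### Counting in subspaces -/

section

variable {F H : Type*} [Field F] [AddCommGroup H] [Module F H]

open Classical in
lemma sum_ite_mem [Finite F] [Module.Finite F H] [Fintype H] (U : Submodule F H) :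
    ∑ v : H, (if v ∈ U then (1 : ℂ) else 0) = (Nat.card F : ℂ) ^ Module.finrank F U := by
  have := Module.natCard_eq_pow_finrank (K := F) (V := U)
  rw [Finset.sum_boole, ← Nat.cast_pow, ← this, ← Nat.subtype_card (p := (· ∈ U)) _ (by simp)]

open Classical in
lemma sum_subtype_ite_mem [Finite F] [Module.Finite F H] (U V : Submodule F H) [Fintype U] :
    ∑ v : U, (if (v : H) ∈ V then (1 : ℂ) else 0) =
      (Nat.card F : ℂ) ^ Module.finrank F (V ⊓ U : Submodule F H) := by
  have : Finite H := Module.finite_of_finite F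
  let _ := Fintype.ofFinite H
  rw [← sum_ite_mem, ← Finset.sum_subtype (p := (· ∈ U)) (Finset.univ.filter (· ∈ U)) (by simp)
    (fun v => if v ∈ V then (1 : ℂ) else 0), Finset.sum_filter]
  refine Finset.sum_congr rfl fun v _ => ?_
  by_cases h1 : v ∈ U <;> by_cases h2 : v ∈ V <;> simp [h1, h2]

lemma span_sup_eq_of_covBy {x z : Submodule F H} (hc : x ⋖ z) {v : H} (hv : v ∈ z) (hx : v ∉ x) :
    F ∙ v ⊔ x = z :=
  eq_of_le_of_not_lt (sup_le (by simpa using hv) hc.le)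
    (hc.2 (Submodule.covBy_span_singleton_sup hx).lt)

lemma finrank_of_covBy [Module.Finite F H] {x z : Submodule F H} (hc : x ⋖ z) :
    Module.finrank F z = Module.finrank F x + 1 := by
  obtain ⟨v, hv, hx⟩ := SetLike.exists_of_lt hc.lt
  rw [← span_sup_eq_of_covBy hc hv hx]
  have h0 : v ≠ 0 := fun h => hx (h ▸ x.zero_mem)
  have h1 := Submodule.finrank_sup_add_finrank_inf_eq (F ∙ v) x
  have h2 : F ∙ v ⊓ x = ⊥ := by
    rw [← disjoint_iff, disjoint_comm, Submodule.disjoint_span_singleton' h0]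
    exact hx
  rw [h2, finrank_bot, finrank_span_singleton h0] at h1
  omega

lemma mem_dualAnnihilator_sup {x y : Submodule F H} {φ : Module.Dual F H} :
    φ ∈ (x ⊔ y).dualAnnihilator ↔ φ ∈ x.dualAnnihilator ∧ φ ∈ y.dualAnnihilator := by
  rw [Submodule.dualAnnihilator_sup_eq, Submodule.mem_inf]

lemma finrank_dualAnnihilator [Module.Finite F H] (x : Submodule F H) :
    Module.finrank F x.dualAnnihilator = Module.finrank F H - Module.finrank F x := by
  have := Subspace.finrank_add_finrank_dualAnnihilator_eq x
  omega

lemma inf_ker_covBy {x : Submodule F H} {φ : Module.Dual F H} (hφ : φ ∉ x.dualAnnihilator) :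
    x ⊓ LinearMap.ker φ ⋖ x := by
  rw [Submodule.mem_dualAnnihilator] at hφ
  push Not at hφ
  obtain ⟨v, hv, hv0⟩ := hφ
  have h1 : F ∙ v ⊔ (x ⊓ LinearMap.ker φ) = x := by
    refine le_antisymm (sup_le (by simpa using hv) inf_le_left) fun w hw => ?_
    have : w = (φ w / φ v) • v + (w - (φ w / φ v) • v) := by abel
    rw [this]
    refine Submodule.add_mem_sup (Submodule.smul_mem _ _ (Submodule.mem_span_singleton_self v))
      ⟨x.sub_mem hw (x.smul_mem _ hv), ?_⟩
    simp [hv0]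
  conv_rhs => rw [← h1]
  exact Submodule.covBy_span_singleton_sup fun h => hv0 h.2

end

section

variable {F H : Type*} [Field F] [AddCommGroup H] [Module F H] {h : Submodule F H}

/-! ### Subspaces underlying the poset -/

/-- The subspace of `H` underlying an element of the poset. -/
def toSubmodule (x : AttenuatedSpace h) : Submodule F H := x.1

/-- The element of the poset given by a subspace that meets `h` trivially. -/
def ofSubmodule (x : Submodule F H) (hx : x ⊓ h = ⊥) : AttenuatedSpace h := ⟨x, hx⟩

@[simp] lemma toSubmodule_ofSubmodule (x : Submodule F H) (hx : x ⊓ h = ⊥) :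
    (ofSubmodule x hx).toSubmodule = x := rfl

lemma toSubmodule_injective : Function.Injective (toSubmodule (h := h)) := Subtype.val_injective

lemma toSubmodule_inf (x : AttenuatedSpace h) : x.toSubmodule ⊓ h = ⊥ := x.2

lemma toSubmodule_le {x y : AttenuatedSpace h} : x.toSubmodule ≤ y.toSubmodule ↔ x ≤ y := Iff.rfl

lemma toSubmodule_lt {x y : AttenuatedSpace h} : x.toSubmodule < y.toSubmodule ↔ x < y := Iff.rfl

lemma rank_eq (x : AttenuatedSpace h) : x.rank = Module.finrank F x.toSubmodule := rfl

lemma covBy_iff {x y : AttenuatedSpace h} : x ⋖ y ↔ x.toSubmodule ⋖ y.toSubmodule := by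
  refine ⟨fun hc => ⟨toSubmodule_lt.2 hc.lt, fun z h1 h2 => ?_⟩,
    fun hc => ⟨toSubmodule_lt.1 hc.lt, fun z h1 h2 =>
      hc.2 (toSubmodule_lt.2 h1) (toSubmodule_lt.2 h2)⟩⟩
  have hz : z ⊓ h = ⊥ := le_bot_iff.1 ((inf_le_inf_right h h2.le).trans y.toSubmodule_inf.le)
  exact hc.2 (c := ofSubmodule z hz) h1 h2

lemma finrank_sup_of_inf_eq_bot [Module.Finite F H] {x : Submodule F H} (hx : x ⊓ h = ⊥) :
    Module.finrank F (x ⊔ h : Submodule F H) = Module.finrank F x + Module.finrank F h := by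
  have := Submodule.finrank_sup_add_finrank_inf_eq x h
  rwa [hx, finrank_bot, add_zero] at this

lemma span_sup_inf_eq_bot {x : Submodule F H} (hx : x ⊓ h = ⊥) {v : H} (hv : v ∉ x ⊔ h) :
    (F ∙ v ⊔ x) ⊓ h = ⊥ := by
  rw [Submodule.eq_bot_iff]
  rintro w ⟨hw, hwh⟩
  obtain ⟨a, ha, b, hb, rfl⟩ := Submodule.mem_sup.1 hw
  obtain ⟨c, rfl⟩ := Submodule.mem_span_singleton.1 ha
  by_cases hc : c = 0
  · subst hc
    have : (0 : F) • v + b ∈ x ⊓ h := ⟨by simpa using hb, hwh⟩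
    rwa [hx, Submodule.mem_bot] at this
  · refine absurd ?_ hv
    have h1 : c • v ∈ x ⊔ h := by
      have : c • v = -b + (c • v + b) := by abel
      rw [this]
      exact Submodule.add_mem_sup (x.neg_mem hb) hwh
    exact ((x ⊔ h).smul_mem_iff hc).1 h1

variable [Finite F] [Module.Finite F H]

open Classical in
/-- Each vector outside `x ⊔ h` lies in exactly one cover of `x`. -/
lemma sum_covers (x : AttenuatedSpace h) :
    (∑ z, if x ⋖ z then (1 : ℂ) else 0) * ((Nat.card F - 1) * (Nat.card F : ℂ) ^ x.rank) =
      (Nat.card F : ℂ) ^ Module.finrank F H -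
        (Nat.card F : ℂ) ^ (x.rank + Module.finrank F h) := by
  have : Finite H := Module.finite_of_finite F
  let _ := Fintype.ofFinite H
  have key : ∀ v : H, (∑ z : AttenuatedSpace h, (if x ⋖ z then (1 : ℂ) else 0) *
      ((if v ∈ z.toSubmodule then 1 else 0) - (if v ∈ x.toSubmodule then 1 else 0))) =
      (if v ∈ (⊤ : Submodule F H) then 1 else 0) - (if v ∈ x.toSubmodule ⊔ h then 1 else 0) := by
    intro v
    by_cases hv : v ∈ x.toSubmodule ⊔ h
    · rw [if_pos Submodule.mem_top, if_pos hv, sub_self]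
      refine Finset.sum_eq_zero fun z _ => ?_
      by_cases hz : x ⋖ z
      · have : v ∈ z.toSubmodule ↔ v ∈ x.toSubmodule := by
          refine ⟨fun hvz => ?_, fun hvx => toSubmodule_le.2 hz.le hvx⟩
          obtain ⟨a, ha, b, hb, rfl⟩ := Submodule.mem_sup.1 hv
          have h1 : b ∈ z.toSubmodule ⊓ h := ⟨by
            have := z.toSubmodule.sub_mem hvz (toSubmodule_le.2 hz.le ha)
            rwa [add_sub_cancel_left] at this, hb⟩
          rw [z.toSubmodule_inf, Submodule.mem_bot] at h1
          rwa [h1, add_zero]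
        simp [this]
      · simp [hz]
    · have hvx : v ∉ x.toSubmodule := fun h' => hv (Submodule.mem_sup_left h')
      rw [if_pos Submodule.mem_top, if_neg hv, if_neg hvx,
        Finset.sum_eq_single (ofSubmodule (F ∙ v ⊔ x.toSubmodule)
          (span_sup_inf_eq_bot x.toSubmodule_inf hv))]
      · rw [if_pos, if_pos]
        · simp
        · exact Submodule.mem_sup_left (Submodule.mem_span_singleton_self v)
        · exact covBy_iff.2 (Submodule.covBy_span_singleton_sup hvx)
      · intro z _ hz
        by_cases hc : x ⋖ z
        · rw [if_neg (c := v ∈ z.toSubmodule)]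
          · simp
          · exact fun hvz => hz (toSubmodule_injective
              (span_sup_eq_of_covBy (covBy_iff.1 hc) hvz hvx).symm)
        · simp [hc]
      · simp
  have h1 := Finset.sum_congr (rfl : (Finset.univ : Finset H) = Finset.univ) fun v _ => key v
  rw [Finset.sum_comm, Finset.sum_sub_distrib, sum_ite_mem, sum_ite_mem, finrank_top,
    finrank_sup_of_inf_eq_bot x.toSubmodule_inf] at h1
  rw [rank_eq, ← h1, Finset.sum_mul]
  refine Finset.sum_congr rfl fun z _ => ?_
  rw [← Finset.mul_sum, Finset.sum_sub_distrib, sum_ite_mem, sum_ite_mem]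
  by_cases hc : x ⋖ z
  · rw [finrank_of_covBy (covBy_iff.1 hc)]
    ring
  · simp [hc]

open Classical in
/-- Each functional that does not vanish on `x` vanishes on exactly one coatom of `x`. -/
lemma sum_coatoms (x : AttenuatedSpace h) :
    (∑ z, if z ⋖ x then (1 : ℂ) else 0) * (Nat.card F - 1) = (Nat.card F : ℂ) ^ x.rank - 1 := by
  have : Finite (Module.Dual F H) := Module.finite_of_finite F
  let _ := Fintype.ofFinite (Module.Dual F H)
  have key : ∀ φ : Module.Dual F H, (∑ z : AttenuatedSpace h, (if z ⋖ x then (1 : ℂ) else 0) *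
      ((if φ ∈ z.toSubmodule.dualAnnihilator then 1 else 0) -
        (if φ ∈ x.toSubmodule.dualAnnihilator then 1 else 0))) =
      (if φ ∈ (⊤ : Submodule F (Module.Dual F H)) then 1 else 0) -
        (if φ ∈ x.toSubmodule.dualAnnihilator then 1 else 0) := by
    intro φ
    by_cases hφ : φ ∈ x.toSubmodule.dualAnnihilator
    · rw [if_pos Submodule.mem_top, if_pos hφ, sub_self]
      refine Finset.sum_eq_zero fun z _ => ?_
      by_cases hz : z ⋖ x
      · rw [if_pos (c := φ ∈ z.toSubmodule.dualAnnihilator)]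
        · simp
        · exact Submodule.dualAnnihilator_anti (toSubmodule_le.2 hz.le) hφ
      · simp [hz]
    · have hcov := inf_ker_covBy hφ
      rw [if_pos Submodule.mem_top, if_neg hφ,
        Finset.sum_eq_single (ofSubmodule (x.toSubmodule ⊓ LinearMap.ker φ) (le_bot_iff.1
          ((inf_le_inf_right h inf_le_left).trans x.toSubmodule_inf.le)))]
      · rw [if_pos, if_pos]
        · simp
        · exact (Submodule.mem_dualAnnihilator φ).2 fun w hw => hw.2
        · exact covBy_iff.2 hcov
      · intro z _ hz
        by_cases hc : z ⋖ x
        · rw [if_neg (c := φ ∈ z.toSubmodule.dualAnnihilator)]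
          · simp
          · intro hφz
            refine hz (toSubmodule_injective ?_)
            have hle : z.toSubmodule ≤ x.toSubmodule ⊓ LinearMap.ker φ :=
              le_inf (toSubmodule_le.2 hc.le) fun w hw =>
                (Submodule.mem_dualAnnihilator φ).1 hφz w hw
            exact eq_of_le_of_not_lt hle fun hlt => (covBy_iff.1 hc).2 hlt hcov.lt
        · simp [hc]
      · simp
  have h1 := Finset.sum_congr (rfl : (Finset.univ : Finset (Module.Dual F H)) = Finset.univ)
    fun φ _ => key φ
  rw [Finset.sum_comm, Finset.sum_sub_distrib, sum_ite_mem, sum_ite_mem, finrank_top,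
    Subspace.dual_finrank_eq, finrank_dualAnnihilator] at h1
  have hle : Module.finrank F x.toSubmodule ≤ Module.finrank F H := Submodule.finrank_le _
  have hq : (Nat.card F : ℂ) ≠ 0 := by exact_mod_cast Nat.card_pos.ne'
  rw [rank_eq]
  refine mul_right_cancel₀ (pow_ne_zero (Module.finrank F H - Module.finrank F x.toSubmodule) hq) ?_
  rw [sub_mul, ← pow_add, Nat.add_sub_cancel' hle, one_mul, ← h1, mul_assoc, Finset.sum_mul]
  refine Finset.sum_congr rfl fun z _ => ?_
  rw [← Finset.mul_sum, Finset.sum_sub_distrib, sum_ite_mem, sum_ite_mem]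
  by_cases hc : z ⋖ x
  · have h2 := finrank_of_covBy (covBy_iff.1 hc)
    rw [finrank_dualAnnihilator, finrank_dualAnnihilator, h2]
    have : Module.finrank F H - Module.finrank F z.toSubmodule =
      Module.finrank F H - (Module.finrank F z.toSubmodule + 1) + 1 := by omega
    rw [this]
    ring
  · simp [hc]

end

end AttenuatedSpace

namespace AttenuatedSpace

/-! ### Shears -/

section

variable {F H : Type*} [Field F] [AddCommGroup H] [Module F H] {h : Submodule F H}

/-- The action on the poset of a linear automorphism of `H` that preserves `h`. -/
def mapIso (e : H ≃ₗ[F] H) (he : h.map (e : H →ₗ[F] H) = h) :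
    AttenuatedSpace h ≃o AttenuatedSpace h where
  toEquiv := (Submodule.orderIsoMapComap e).toEquiv.subtypeEquiv fun x => by
    change x ⊓ h = ⊥ ↔ x.map (e : H →ₗ[F] H) ⊓ h = ⊥
    conv_rhs => rw [← he, ← Submodule.map_inf _ e.injective, Submodule.map_eq_bot_iff (e := e)]
  map_rel_iff' {x y} := (Submodule.orderIsoMapComap e).map_rel_iff' (a := x.1) (b := y.1)

/-- The shear `v ↦ v + φ(v) u`, for `u ∈ h` and a functional `φ` that vanishes on `h`. -/
def shear (u : h) (φ : h.dualAnnihilator) : H ≃ₗ[F] H :=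
  LinearEquiv.transvection (f := φ.1) (v := u.1) ((Submodule.mem_dualAnnihilator φ.1).1 φ.2 u.1 u.2)

@[simp] lemma shear_apply (u : h) (φ : h.dualAnnihilator) (v : H) :
    shear u φ v = v + φ.1 v • u.1 := rfl

lemma map_shear_of_mem_dualAnnihilator {x : Submodule F H} (u : h) {φ : h.dualAnnihilator}
    (hφ : φ.1 ∈ x.dualAnnihilator) : x.map (shear u φ : H →ₗ[F] H) = x := by
  have key : ∀ v ∈ x, shear u φ v = v := fun v hv => by
    simp [(Submodule.mem_dualAnnihilator φ.1).1 hφ v hv]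
  ext w
  simp only [Submodule.mem_map, LinearEquiv.coe_coe]
  exact ⟨fun ⟨v, hv, hw⟩ => by rwa [← hw, key v hv], fun hw => ⟨w, hw, key w hw⟩⟩

/-- The automorphism of the poset induced by a shear. -/
def shearIso (u : h) (φ : h.dualAnnihilator) : AttenuatedSpace h ≃o AttenuatedSpace h :=
  mapIso (shear u φ) (map_shear_of_mem_dualAnnihilator u φ.2)

@[simp] lemma toSubmodule_shearIso (u : h) (φ : h.dualAnnihilator) (x : AttenuatedSpace h) :
    (shearIso u φ x).toSubmodule = x.toSubmodule.map (shear u φ : H →ₗ[F] H) := rfl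

lemma shear_mem_shearIso {u : h} {φ : h.dualAnnihilator} {x : AttenuatedSpace h} {v : H}
    (hv : v ∈ x.toSubmodule) : v + φ.1 v • u.1 ∈ (shearIso u φ x).toSubmodule :=
  ⟨v, hv, rfl⟩

lemma rank_shearIso (u : h) (φ : h.dualAnnihilator) (x : AttenuatedSpace h) :
    (shearIso u φ x).rank = x.rank :=
  LinearEquiv.finrank_map_eq (shear u φ) x.toSubmodule

lemma eq_zero_of_mem_of_mem {x : AttenuatedSpace h} {v : H} (hv : v ∈ x.toSubmodule)
    (hvh : v ∈ h) : v = 0 := by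
  have : v ∈ x.toSubmodule ⊓ h := ⟨hv, hvh⟩
  rwa [x.toSubmodule_inf] at this

lemma inf_shearIso {u : h} {φ : h.dualAnnihilator} {x y : AttenuatedSpace h}
    (hy : shearIso u φ x = y) (hu : u ≠ 0) :
    x.toSubmodule ⊓ y.toSubmodule = x.toSubmodule ⊓ LinearMap.ker φ.1 := by
  ext v
  refine and_congr_right fun hv => ?_
  have h1 := shear_mem_shearIso (u := u) (φ := φ) hv
  rw [hy] at h1
  rw [SetLike.mem_coe, SetLike.mem_coe, LinearMap.mem_ker]
  constructor
  · intro hvy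
    have h2 := y.toSubmodule.sub_mem h1 hvy
    rw [add_sub_cancel_left] at h2
    have h3 := eq_zero_of_mem_of_mem h2 (h.smul_mem _ u.2)
    simpa [hu] using h3
  · intro h0
    rwa [h0, zero_smul, add_zero] at h1

lemma shearIso_zero (φ : h.dualAnnihilator) (x : AttenuatedSpace h) : shearIso 0 φ x = x := by
  apply toSubmodule_injective
  have : shear 0 φ = LinearEquiv.refl F H := by ext v; simp
  rw [toSubmodule_shearIso, this]
  exact Submodule.map_id _

lemma shearIso_eq_self_iff {u : h} {φ : h.dualAnnihilator} {x : AttenuatedSpace h} :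
    shearIso u φ x = x ↔ u = 0 ∨ φ.1 ∈ x.toSubmodule.dualAnnihilator := by
  constructor
  · intro hx
    by_cases hu : u = 0
    · exact Or.inl hu
    · have := inf_shearIso hx hu
      rw [inf_idem] at this
      exact Or.inr ((Submodule.mem_dualAnnihilator _).2 fun w hw => (this.le hw).2)
  · rintro (rfl | hφ)
    · exact shearIso_zero _ _
    · exact toSubmodule_injective (map_shear_of_mem_dualAnnihilator u hφ)

/-- Two elements of the poset are *sheared* if they share a common coatom but their sum meets `h`
nontrivially. -/
def Sheared (x y : AttenuatedSpace h) : Prop :=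
  x.toSubmodule ⊓ y.toSubmodule ⋖ x.toSubmodule ∧ x.toSubmodule ⊓ y.toSubmodule ⋖ y.toSubmodule ∧
    (x.toSubmodule ⊔ y.toSubmodule) ⊓ h ≠ ⊥

lemma sheared_of_shearIso_eq {u : h} {φ : h.dualAnnihilator} {x y : AttenuatedSpace h}
    (hxy : x ≠ y) (hy : shearIso u φ x = y) : Sheared x y := by
  have hx : ¬ (u = 0 ∨ φ.1 ∈ x.toSubmodule.dualAnnihilator) := by
    rw [← shearIso_eq_self_iff, hy]
    exact hxy.symm
  push Not at hx
  have hinf := inf_shearIso hy hx.1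
  have hcov := inf_ker_covBy hx.2
  refine ⟨hinf ▸ hcov, ?_, ?_⟩
  · have h1 := (apply_covBy_apply_iff (Submodule.orderIsoMapComap (shear u φ))).2 hcov
    rw [Submodule.orderIsoMapComap_apply, Submodule.orderIsoMapComap_apply] at h1
    rw [hinf, ← hy, toSubmodule_shearIso]
    convert h1 using 1
    exact (map_shear_of_mem_dualAnnihilator u ((Submodule.mem_dualAnnihilator _).2
      fun w hw => (Submodule.mem_inf.1 hw).2)).symm
  · have h2 := hx.2
    rw [Submodule.mem_dualAnnihilator] at h2
    push Not at h2
    obtain ⟨v, hv, hv0⟩ := h2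
    have h1 := shear_mem_shearIso (u := u) (φ := φ) hv
    rw [hy] at h1
    have h3 : φ.1 v • u.1 ∈ (x.toSubmodule ⊔ y.toSubmodule) ⊓ h := by
      refine ⟨?_, h.smul_mem _ u.2⟩
      have : φ.1 v • u.1 = -v + (v + φ.1 v • u.1) := by abel
      rw [this]
      exact Submodule.add_mem_sup (x.toSubmodule.neg_mem hv) h1
    intro h4
    rw [h4, Submodule.mem_bot, smul_eq_zero] at h3
    exact h3.elim hv0 fun h5 => hx.1 (Subtype.ext h5)

lemma Sheared.ne {x y : AttenuatedSpace h} (hxy : Sheared x y) : x ≠ y := by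
  rintro rfl
  exact hxy.1.lt.ne (inf_idem _)

variable [Module.Finite F H]

lemma Sheared.rank_eq {x y : AttenuatedSpace h} (hxy : Sheared x y) : x.rank = y.rank := by
  rw [AttenuatedSpace.rank_eq, AttenuatedSpace.rank_eq, finrank_of_covBy hxy.1,
    finrank_of_covBy hxy.2.1]

open Classical in
/-- For a functional `φ`, the number of shears along `φ` that map `x` to `y` is one if `φ` vanishes
on `x ⊓ y` but not on `x`, and zero otherwise. -/
lemma Sheared.sum_shearIso [Fintype h] {x y : AttenuatedSpace h} (hxy : Sheared x y)
    (φ : h.dualAnnihilator) :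
    (∑ u : h, if shearIso u φ x = y then (1 : ℂ) else 0) =
      (if φ.1 ∈ (x.toSubmodule ⊓ y.toSubmodule).dualAnnihilator then 1 else 0) -
        (if φ.1 ∈ x.toSubmodule.dualAnnihilator then 1 else 0) := by
  by_cases hφx : φ.1 ∈ x.toSubmodule.dualAnnihilator
  · rw [if_pos hφx, if_pos (Submodule.dualAnnihilator_anti inf_le_left hφx), sub_self]
    refine Finset.sum_eq_zero fun u _ => if_neg ?_
    rw [shearIso_eq_self_iff.2 (Or.inr hφx)]
    exact hxy.ne
  rw [if_neg hφx, sub_zero]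
  have hu0 : ∀ u : h, shearIso u φ x = y → u ≠ 0 := by
    rintro u hu rfl
    exact hxy.ne (by rw [← hu, shearIso_zero])
  by_cases hφ : φ.1 ∈ (x.toSubmodule ⊓ y.toSubmodule).dualAnnihilator
  · rw [if_pos hφ]
    obtain ⟨w, hw, hw0⟩ := (Submodule.ne_bot_iff _).1 hxy.2.2
    obtain ⟨a, ha, b, hb, hab⟩ := Submodule.mem_sup.1 hw.1
    have hay : a ∉ y.toSubmodule := fun hay =>
      hw0 (eq_zero_of_mem_of_mem (hab ▸ y.toSubmodule.add_mem hay hb) hw.2)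
    have hspan := span_sup_eq_of_covBy hxy.1 ha fun h' => hay h'.2
    have hφa : φ.1 a ≠ 0 := by
      intro h0
      refine hφx ?_
      rw [← hspan, mem_dualAnnihilator_sup]
      refine ⟨(Submodule.mem_dualAnnihilator _).2 fun v hv => ?_, hφ⟩
      obtain ⟨c, rfl⟩ := Submodule.mem_span_singleton.1 hv
      rw [map_smul, h0, smul_zero]
    -- The shear must move `a` to `a - w = -b`.
    have hwh : w ∈ h := hw.2
    rw [Finset.sum_eq_single (⟨(-(φ.1 a)⁻¹) • w, h.smul_mem _ hwh⟩ : h)]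
    · refine if_pos (toSubmodule_injective ?_)
      refine Submodule.eq_of_le_of_finrank_eq ?_ ?_
      · rw [toSubmodule_shearIso, ← hspan, Submodule.map_sup, sup_le_iff,
          map_shear_of_mem_dualAnnihilator _ hφ]
        refine ⟨?_, inf_le_right⟩
        rw [Submodule.map_span_le]
        intro v hv
        rw [Set.mem_singleton_iff.1 hv]
        have : φ.1 a • -(φ.1 a)⁻¹ • w = -w := by
          rw [smul_smul, mul_neg, mul_inv_cancel₀ hφa, neg_smul, one_smul]
        rw [LinearEquiv.coe_coe, shear_apply, this, ← hab]
        convert y.toSubmodule.neg_mem hb using 1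
        abel
      · rw [← AttenuatedSpace.rank_eq, ← AttenuatedSpace.rank_eq, rank_shearIso, hxy.rank_eq]
    · intro u _ hu
      refine if_neg fun hy => hu ?_
      have h1 := shear_mem_shearIso (u := u) (φ := φ) ha
      rw [hy] at h1
      have h2 := y.toSubmodule.add_mem h1 hb
      have h3 : a + φ.1 a • u.1 + b = w + φ.1 a • u.1 := by rw [← hab]; abel
      rw [h3] at h2
      have h4 := eq_zero_of_mem_of_mem h2 (h.add_mem hw.2 (h.smul_mem _ u.2))
      apply Subtype.ext
      rw [add_eq_zero_iff_eq_neg] at h4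
      simp [h4, smul_smul, inv_mul_cancel₀ hφa]
    · simp
  · rw [if_neg hφ]
    refine Finset.sum_eq_zero fun u _ => if_neg fun hu => hφ ?_
    rw [inf_shearIso hu (hu0 u hu)]
    exact (Submodule.mem_dualAnnihilator _).2 fun w hw => hw.2

lemma rank_add_finrank_le (x : AttenuatedSpace h) :
    x.rank + Module.finrank F h ≤ Module.finrank F H := by
  rw [rank_eq, ← finrank_sup_of_inf_eq_bot x.toSubmodule_inf]
  exact Submodule.finrank_le _

lemma rank_le {N M : ℕ} (hH : Module.finrank F H = N + M) (hh : Module.finrank F h = M)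
    (x : AttenuatedSpace h) : x.rank ≤ N := by
  have := x.rank_add_finrank_le
  omega

lemma diagK_eq {N M : ℕ} (hH : Module.finrank F H = N + M) (hh : Module.finrank F h = M) :
    diagK h N M = Matrix.diagonal fun x => (Nat.card F : ℂ) ^ (N + M - x.rank) := by
  ext x y
  rw [diagK, Matrix.sum_apply, Matrix.diagonal_apply]
  by_cases hxy : x = y
  · subst hxy
    simp [proj, Nat.lt_succ_of_le (rank_le hH hh x)]
  · simp [proj, hxy]

variable [Finite F]

variable (h) in
/-- The sum over all shears of the permutation matrices by which they act on the poset. -/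
noncomputable def shearSum : Mat h :=
  haveI : Finite H := Module.finite_of_finite F
  haveI : Finite (Module.Dual F H) := Module.finite_of_finite F
  letI : Fintype h := Fintype.ofFinite h
  letI : Fintype h.dualAnnihilator := Fintype.ofFinite h.dualAnnihilator
  ∑ φ : h.dualAnnihilator, ∑ u : h, (shearIso u φ).toEquiv.toPEquiv.toMatrix

lemma shearSum_apply [Fintype h] [Fintype h.dualAnnihilator] (x y : AttenuatedSpace h) :
    shearSum h x y =
      ∑ φ : h.dualAnnihilator, ∑ u : h, if shearIso u φ x = y then (1 : ℂ) else 0 := by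
  simp only [shearSum, Matrix.sum_apply, PEquiv.toMatrix_apply, Equiv.toPEquiv_apply,
    Option.mem_some_iff]
  convert rfl
  simp

lemma commute_shearSum_of_forall (A : Mat h)
    (hA : ∀ u φ x y, A (shearIso u φ x) (shearIso u φ y) = A x y) :
    Commute A (shearSum h) := by
  rw [commute_iff_eq, shearSum, Matrix.mul_sum, Matrix.sum_mul]
  refine Finset.sum_congr rfl fun φ _ => ?_
  rw [Matrix.mul_sum, Matrix.sum_mul]
  refine Finset.sum_congr rfl fun u _ => ?_
  rw [PEquiv.mul_toMatrix_toPEquiv, PEquiv.toMatrix_toPEquiv_mul]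
  ext x y
  have := hA u φ x ((shearIso u φ).symm y)
  rw [OrderIso.apply_symm_apply] at this
  exact this.symm

open Classical in
lemma lowering_commute_shearSum : Commute (lowering h) (shearSum h) :=
  commute_shearSum_of_forall _ fun u φ _ _ =>
    if_congr (apply_covBy_apply_iff (shearIso u φ)) rfl rfl

open Classical in
lemma raising_commute_shearSum : Commute (raising h) (shearSum h) :=
  commute_shearSum_of_forall _ fun u φ _ _ =>
    if_congr (apply_covBy_apply_iff (shearIso u φ)) rfl rfl

lemma diagonal_rank_commute_shearSum (f : ℕ → ℂ) :
    Commute (Matrix.diagonal fun x : AttenuatedSpace h => f x.rank) (shearSum h) :=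
  commute_shearSum_of_forall _ fun u φ x y => by
    simp [Matrix.diagonal_apply, rank_shearIso]

lemma sum_dualAnnihilator_ite_mem [Fintype h.dualAnnihilator] (V : Submodule F H)
    [DecidablePred (· ∈ V.dualAnnihilator)] :
    ∑ φ : h.dualAnnihilator, (if φ.1 ∈ V.dualAnnihilator then (1 : ℂ) else 0) =
      (Nat.card F : ℂ) ^ (Module.finrank F H - Module.finrank F (V ⊔ h : Submodule F H)) := by
  classical
  rw [← finrank_dualAnnihilator, Submodule.dualAnnihilator_sup_eq, ← sum_subtype_ite_mem]
  convert rfl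

lemma shearSum_self (x : AttenuatedSpace h) :
    shearSum h x x = (Nat.card F : ℂ) ^ (Module.finrank F H - Module.finrank F h) +
      ((Nat.card F : ℂ) ^ Module.finrank F h - 1) *
        (Nat.card F : ℂ) ^ (Module.finrank F H - (x.rank + Module.finrank F h)) := by
  classical
  have : Finite H := Module.finite_of_finite F
  have : Finite (Module.Dual F H) := Module.finite_of_finite F
  let _ : Fintype h := Fintype.ofFinite h
  let _ : Fintype h.dualAnnihilator := Fintype.ofFinite h.dualAnnihilator
  rw [shearSum_apply, Finset.sum_comm]
  have key : ∀ u : h, (∑ φ : h.dualAnnihilator, if shearIso u φ x = x then (1 : ℂ) else 0) =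
      (∑ φ : h.dualAnnihilator, if φ.1 ∈ x.toSubmodule.dualAnnihilator then (1 : ℂ) else 0) +
      if u = 0 then (∑ φ : h.dualAnnihilator,
        if φ.1 ∈ (⊥ : Submodule F H).dualAnnihilator then (1 : ℂ) else 0) -
        (∑ φ : h.dualAnnihilator, if φ.1 ∈ x.toSubmodule.dualAnnihilator then (1 : ℂ) else 0)
      else 0 := by
    intro u
    simp only [shearIso_eq_self_iff]
    by_cases hu : u = 0
    · simp [hu]
    · simp [hu]
  rw [Finset.sum_congr rfl fun u _ => key u, Finset.sum_add_distrib, Finset.sum_ite_eq',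
    if_pos (Finset.mem_univ _), Finset.sum_const, sum_dualAnnihilator_ite_mem,
    sum_dualAnnihilator_ite_mem, bot_sup_eq, finrank_sup_of_inf_eq_bot x.toSubmodule_inf, rank_eq,
    Finset.card_univ, ← Nat.card_eq_fintype_card, Module.natCard_eq_pow_finrank (K := F)]
  simp only [nsmul_eq_mul, Nat.cast_pow]
  ring

lemma shearSum_of_sheared {x y : AttenuatedSpace h} (hxy : Sheared x y) :
    shearSum h x y = ((Nat.card F : ℂ) - 1) *
      (Nat.card F : ℂ) ^ (Module.finrank F H - (x.rank + Module.finrank F h)) := by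
  classical
  have : Finite H := Module.finite_of_finite F
  have : Finite (Module.Dual F H) := Module.finite_of_finite F
  let _ : Fintype h := Fintype.ofFinite h
  let _ : Fintype h.dualAnnihilator := Fintype.ofFinite h.dualAnnihilator
  have hbot : x.toSubmodule ⊓ y.toSubmodule ⊓ h = ⊥ :=
    le_bot_iff.1 ((inf_le_inf_right h inf_le_left).trans x.toSubmodule_inf.le)
  have h1 := x.rank_add_finrank_le
  have h2 := finrank_of_covBy hxy.1
  rw [shearSum_apply, Finset.sum_congr rfl fun φ _ => hxy.sum_shearIso φ, Finset.sum_sub_distrib,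
    sum_dualAnnihilator_ite_mem, sum_dualAnnihilator_ite_mem,
    finrank_sup_of_inf_eq_bot x.toSubmodule_inf, finrank_sup_of_inf_eq_bot hbot, rank_eq]
  rw [rank_eq] at h1
  have h3 : Module.finrank F H - (Module.finrank F (x.toSubmodule ⊓ y.toSubmodule : Submodule F H)
      + Module.finrank F h) =
      Module.finrank F H - (Module.finrank F x.toSubmodule + Module.finrank F h) + 1 := by omega
  rw [h3]
  ring

lemma shearSum_of_not_sheared {x y : AttenuatedSpace h} (hne : x ≠ y) (hxy : ¬ Sheared x y) :
    shearSum h x y = 0 := by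
  have : Finite H := Module.finite_of_finite F
  have : Finite (Module.Dual F H) := Module.finite_of_finite F
  let _ : Fintype h := Fintype.ofFinite h
  let _ : Fintype h.dualAnnihilator := Fintype.ofFinite h.dualAnnihilator
  rw [shearSum_apply]
  exact Finset.sum_eq_zero fun φ _ => Finset.sum_eq_zero fun u _ =>
    if_neg fun hu => hxy (sheared_of_shearIso_eq hne hu)

/-! ### The commutator of the lowering and the raising matrix -/

open Classical in
lemma lowering_mul_raising_apply (x y : AttenuatedSpace h) :
    (lowering h * raising h) x y = ∑ z, if x ⋖ z ∧ y ⋖ z then 1 else 0 := by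
  simp [Matrix.mul_apply, lowering, raising, ← ite_and, and_comm]

open Classical in
lemma raising_mul_lowering_apply (x y : AttenuatedSpace h) :
    (raising h * lowering h) x y = ∑ z, if z ⋖ x ∧ z ⋖ y then 1 else 0 := by
  simp [Matrix.mul_apply, lowering, raising, ← ite_and, and_comm]

open Classical in
lemma lowering_mul_raising_apply_of_ne {x y : AttenuatedSpace h} (hxy : x ≠ y) :
    (lowering h * raising h) x y =
      if x.toSubmodule ⊓ y.toSubmodule ⋖ x.toSubmodule ∧
          x.toSubmodule ⊓ y.toSubmodule ⋖ y.toSubmodule ∧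
          (x.toSubmodule ⊔ y.toSubmodule) ⊓ h = ⊥ then 1 else 0 := by
  rw [lowering_mul_raising_apply]
  have hsup : ∀ z : AttenuatedSpace h, x ⋖ z ∧ y ⋖ z →
      x.toSubmodule ⊔ y.toSubmodule = z.toSubmodule := by
    rintro z ⟨hx, hy⟩
    have hle : x.toSubmodule ⊔ y.toSubmodule ≤ z.toSubmodule :=
      sup_le (toSubmodule_le.2 hx.le) (toSubmodule_le.2 hy.le)
    refine eq_of_le_of_not_lt hle ((covBy_iff.1 hx).2 (lt_of_le_of_ne le_sup_left fun he => ?_))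
    have hyx : y ≤ x := toSubmodule_le.1 (he ▸ le_sup_right)
    exact hy.2 (lt_of_le_of_ne hyx hxy.symm) hx.lt
  split_ifs with hc
  · obtain ⟨h1, h2, h3⟩ := hc
    rw [Finset.sum_eq_single (ofSubmodule _ h3)]
    · exact if_pos ⟨covBy_iff.2 (covBy_sup_of_inf_covBy_right h2),
        covBy_iff.2 (covBy_sup_of_inf_covBy_left h1)⟩
    · exact fun z _ hz => if_neg fun hc => hz (toSubmodule_injective (hsup z hc).symm)
    · simp
  · refine Finset.sum_eq_zero fun z _ => if_neg fun hz => hc ?_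
    have hs := hsup z hz
    have h1 := covBy_iff.1 hz.1
    have h2 := covBy_iff.1 hz.2
    rw [← hs] at h1 h2
    exact ⟨inf_covBy_of_covBy_sup_right h2, inf_covBy_of_covBy_sup_left h1,
      hs ▸ z.toSubmodule_inf⟩

open Classical in
lemma raising_mul_lowering_apply_of_ne {x y : AttenuatedSpace h} (hxy : x ≠ y) :
    (raising h * lowering h) x y =
      if x.toSubmodule ⊓ y.toSubmodule ⋖ x.toSubmodule ∧
          x.toSubmodule ⊓ y.toSubmodule ⋖ y.toSubmodule then 1 else 0 := by
  rw [raising_mul_lowering_apply]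
  have hinf : ∀ z : AttenuatedSpace h, z ⋖ x ∧ z ⋖ y →
      z.toSubmodule = x.toSubmodule ⊓ y.toSubmodule := by
    rintro z ⟨hx, hy⟩
    have hle : z.toSubmodule ≤ x.toSubmodule ⊓ y.toSubmodule :=
      le_inf (toSubmodule_le.2 hx.le) (toSubmodule_le.2 hy.le)
    refine eq_of_le_of_not_lt hle fun hlt =>
      (covBy_iff.1 hx).2 hlt (lt_of_le_of_ne inf_le_left fun he => ?_)
    have hyx : x ≤ y := toSubmodule_le.1 (he ▸ inf_le_right)
    exact hy.2 hx.lt (lt_of_le_of_ne hyx hxy)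
  split_ifs with hc
  · rw [Finset.sum_eq_single (ofSubmodule (x.toSubmodule ⊓ y.toSubmodule)
      (le_bot_iff.1 ((inf_le_inf_right h inf_le_left).trans x.toSubmodule_inf.le)))]
    · exact if_pos ⟨covBy_iff.2 hc.1, covBy_iff.2 hc.2⟩
    · exact fun z _ hz => if_neg fun hc => hz (toSubmodule_injective (hinf z hc))
    · simp
  · refine Finset.sum_eq_zero fun z _ => if_neg fun hz => hc ?_
    rw [← hinf z hz]
    exact ⟨covBy_iff.1 hz.1, covBy_iff.1 hz.2⟩

/-- `(q - 1)(LR - RL)K = K² - q^M S`, where `S` is the sum of all shears. -/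
theorem commutator_mul_diagK {N M : ℕ} (hH : Module.finrank F H = N + M)
    (hh : Module.finrank F h = M) :
    ((Nat.card F : ℂ) - 1) • ((lowering h * raising h - raising h * lowering h) * diagK h N M) =
      diagK h N M * diagK h N M - (Nat.card F : ℂ) ^ M • shearSum h := by
  classical
  ext x y
  have hq : (Nat.card F : ℂ) ≠ 0 := by exact_mod_cast Nat.card_pos.ne'
  rw [diagK_eq hH hh, Matrix.diagonal_mul_diagonal]
  simp only [Matrix.smul_apply, Matrix.mul_diagonal, Matrix.sub_apply, smul_eq_mul]
  obtain ⟨j, hj⟩ := Nat.exists_eq_add_of_le (rank_le hH hh x)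
  by_cases hxy : x = y
  · subst hxy
    have h1 := sum_covers x
    have h2 := sum_coatoms x
    rw [lowering_mul_raising_apply, raising_mul_lowering_apply, Matrix.diagonal_apply_eq,
      shearSum_self]
    simp only [and_self]
    have e1 : N + M - x.rank = j + M := by omega
    have e2 : N + M - M = x.rank + j := by omega
    have e3 : N + M - (x.rank + M) = j := by omega
    have e4 : N + M = x.rank + j + M := by omega
    rw [hH, hh, e1, e2, e3]
    rw [hH, hh, e4] at h1
    refine mul_right_cancel₀ (pow_ne_zero x.rank hq) ?_
    simp only [pow_add] at h1 ⊢
    linear_combination (Nat.card F : ℂ) ^ j * (Nat.card F : ℂ) ^ M * h1 -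
      (Nat.card F : ℂ) ^ j * (Nat.card F : ℂ) ^ M * (Nat.card F : ℂ) ^ x.rank * h2
  · rw [Matrix.diagonal_apply_ne _ hxy, lowering_mul_raising_apply_of_ne hxy,
      raising_mul_lowering_apply_of_ne hxy]
    by_cases hs : Sheared x y
    · rw [shearSum_of_sheared hs, if_neg fun hc => hs.2.2 hc.2.2, if_pos ⟨hs.1, hs.2.1⟩, hH, hh,
        ← hs.rank_eq]
      have e1 : N + M - x.rank = j + M := by omega
      have e3 : N + M - (x.rank + M) = j := by omega
      rw [e1, e3]
      ring
    · rw [shearSum_of_not_sheared hxy hs]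
      have : (x.toSubmodule ⊓ y.toSubmodule ⋖ x.toSubmodule ∧
          x.toSubmodule ⊓ y.toSubmodule ⋖ y.toSubmodule ∧
          (x.toSubmodule ⊔ y.toSubmodule) ⊓ h = ⊥) ↔
          (x.toSubmodule ⊓ y.toSubmodule ⋖ x.toSubmodule ∧
          x.toSubmodule ⊓ y.toSubmodule ⋖ y.toSubmodule) := by
        unfold Sheared at hs
        tauto
      simp [this]

end

end AttenuatedSpace

namespace AttenuatedSpace

/-! ### Relations in the incidence algebra -/

/-- The eigenvalue of `K` on the elements of rank `i`. -/
noncomputable def kEigenvalue (F : Type*) (N M i : ℕ) : ℂ := (Nat.card F : ℂ) ^ (N + M - i)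

lemma kEigenvalue_succ {F : Type*} {N M i : ℕ} (hi : i < N) :
    kEigenvalue F N M i = Nat.card F * kEigenvalue F N M (i + 1) := by
  rw [kEigenvalue, kEigenvalue, ← pow_succ']
  congr 1
  omega

section

variable {F H : Type*} [Field F] [AddCommGroup H] [Module F H] {h : Submodule F H}
  {N M : ℕ}

lemma raising_eq_transpose : raising h = (lowering h).transpose := rfl

variable [Module.Finite F H]

lemma diagK_eq_diagonal (hH : Module.finrank F H = N + M) (hh : Module.finrank F h = M) :
    diagK h N M = Matrix.diagonal fun x => kEigenvalue F N M x.rank :=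
  diagK_eq hH hh

lemma rank_of_covBy {x y : AttenuatedSpace h} (hc : x ⋖ y) : y.rank = x.rank + 1 :=
  finrank_of_covBy (covBy_iff.1 hc)

lemma proj_eq_zero (hH : Module.finrank F H = N + M) (hh : Module.finrank F h = M) {i : ℕ}
    (hi : N < i) : proj h i = 0 := by
  rw [proj, Matrix.diagonal_eq_zero]
  funext x
  have := rank_le hH hh x
  exact if_neg (by omega)

lemma sum_proj (hH : Module.finrank F H = N + M) (hh : Module.finrank F h = M) :
    ∑ i ∈ Finset.range (N + 1), proj h i = 1 := by
  ext x y
  rw [Matrix.sum_apply]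
  by_cases hxy : x = y
  · subst hxy
    simp [proj, Nat.lt_succ_of_le (rank_le hH hh x)]
  · simp [proj, hxy]

variable [Finite F]

variable (F) in
lemma card_field_ne_zero : (Nat.card F : ℂ) ≠ 0 := by exact_mod_cast Nat.card_pos.ne'

variable (F) in
lemma one_lt_card_field : 1 < Nat.card F := Finite.one_lt_card

variable (F) in
lemma card_field_sub_one_ne_zero : (Nat.card F : ℂ) - 1 ≠ 0 := by
  rw [sub_ne_zero]
  exact_mod_cast (one_lt_card_field F).ne'

variable (F) in
lemma kEigenvalue_ne_zero (N M i : ℕ) : kEigenvalue F N M i ≠ 0 :=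
  pow_ne_zero _ (card_field_ne_zero F)

variable (F) in
lemma card_field_pow_injective {a b : ℕ} (hab : (Nat.card F : ℂ) ^ a = (Nat.card F : ℂ) ^ b) :
    a = b :=
  Nat.pow_right_injective (one_lt_card_field F) (by exact_mod_cast hab)

lemma diagK_inv (hH : Module.finrank F H = N + M) (hh : Module.finrank F h = M) :
    (diagK h N M)⁻¹ = Matrix.diagonal fun x => (kEigenvalue F N M x.rank)⁻¹ := by
  refine Matrix.inv_eq_right_inv ?_
  rw [diagK_eq_diagonal hH hh, Matrix.diagonal_mul_diagonal]
  simp [kEigenvalue_ne_zero]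

lemma diagK_mul_inv (hH : Module.finrank F H = N + M) (hh : Module.finrank F h = M) :
    diagK h N M * (diagK h N M)⁻¹ = 1 := by
  rw [diagK_inv hH hh, diagK_eq_diagonal hH hh, Matrix.diagonal_mul_diagonal]
  simp [kEigenvalue_ne_zero]

lemma diagK_inv_mul (hH : Module.finrank F H = N + M) (hh : Module.finrank F h = M) :
    (diagK h N M)⁻¹ * diagK h N M = 1 := by
  rw [diagK_inv hH hh, diagK_eq_diagonal hH hh, Matrix.diagonal_mul_diagonal]
  simp [kEigenvalue_ne_zero]

lemma diagK_mul_lowering (hH : Module.finrank F H = N + M) (hh : Module.finrank F h = M) :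
    diagK h N M * lowering h = (Nat.card F : ℂ) • (lowering h * diagK h N M) := by
  ext x y
  rw [diagK_eq_diagonal hH hh, Matrix.diagonal_mul, Matrix.smul_apply, Matrix.mul_diagonal]
  by_cases hc : x ⋖ y
  · have h1 := rank_of_covBy hc
    have h2 := rank_le hH hh y
    rw [h1, kEigenvalue_succ (by omega), smul_eq_mul]
    ring
  · simp [lowering, hc]

lemma raising_mul_diagK (hH : Module.finrank F H = N + M) (hh : Module.finrank F h = M) :
    raising h * diagK h N M = (Nat.card F : ℂ) • (diagK h N M * raising h) := by
  have := congrArg Matrix.transpose (diagK_mul_lowering hH hh)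
  rwa [Matrix.transpose_mul, Matrix.transpose_smul, Matrix.transpose_mul, diagK_eq_diagonal hH hh,
    Matrix.diagonal_transpose, ← raising_eq_transpose, ← diagK_eq_diagonal hH hh] at this

lemma proj_mul_lowering (i : ℕ) : proj h i * lowering h = lowering h * proj h (i + 1) := by
  ext x y
  rw [proj, proj, Matrix.diagonal_mul, Matrix.mul_diagonal]
  by_cases hc : x ⋖ y
  · simp [rank_of_covBy hc]
  · simp [lowering, hc]

lemma lowering_mul_proj_zero : lowering h * proj h 0 = 0 := by
  ext x y
  rw [proj, Matrix.mul_diagonal]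
  by_cases hc : x ⋖ y
  · simp [rank_of_covBy hc]
  · simp [lowering, hc]

lemma proj_mul_raising (i : ℕ) : proj h (i + 1) * raising h = raising h * proj h i := by
  ext x y
  rw [proj, proj, Matrix.diagonal_mul, Matrix.mul_diagonal]
  by_cases hc : y ⋖ x
  · simp [rank_of_covBy hc]
  · simp [raising, hc]

lemma proj_mul_self (i : ℕ) : proj h i * proj h i = proj h i := by
  simp [proj]

lemma proj_mul_of_ne {i j : ℕ} (hij : i ≠ j) : proj h i * proj h j = 0 := by
  rw [proj, proj, Matrix.diagonal_mul_diagonal, Matrix.diagonal_eq_zero]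
  funext x
  by_cases hx : x.rank = i
  · simp [hx, hij]
  · simp [hx]

lemma diagK_mul_proj (hH : Module.finrank F H = N + M) (hh : Module.finrank F h = M) (i : ℕ) :
    diagK h N M * proj h i = kEigenvalue F N M i • proj h i := by
  rw [diagK_eq_diagonal hH hh, proj, Matrix.diagonal_mul_diagonal, ← Matrix.diagonal_smul]
  congr 1
  funext x
  by_cases hx : x.rank = i <;> simp [hx]

lemma proj_mul_diagK (hH : Module.finrank F H = N + M) (hh : Module.finrank F h = M) (i : ℕ) :
    proj h i * diagK h N M = diagK h N M * proj h i := by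
  rw [diagK_eq_diagonal hH hh, proj, Matrix.diagonal_mul_diagonal, Matrix.diagonal_mul_diagonal]
  simp only [mul_comm]

lemma proj_mul_diagK_inv (hH : Module.finrank F H = N + M) (hh : Module.finrank F h = M) (i : ℕ) :
    proj h i * (diagK h N M)⁻¹ = (diagK h N M)⁻¹ * proj h i := by
  rw [diagK_inv hH hh, proj, Matrix.diagonal_mul_diagonal, Matrix.diagonal_mul_diagonal]
  simp only [mul_comm]

lemma raising_mem : raising h ∈ incAlg h N M := Algebra.subset_adjoin (by simp)

lemma lowering_mem : lowering h ∈ incAlg h N M := Algebra.subset_adjoin (by simp)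

lemma diagK_mem : diagK h N M ∈ incAlg h N M := Algebra.subset_adjoin (by simp)

lemma diagK_inv_mem : (diagK h N M)⁻¹ ∈ incAlg h N M := Algebra.subset_adjoin (by simp)

/-- The projections `F_i` are Lagrange polynomials in `K`, whose eigenvalues are distinct. -/
lemma proj_mem (hH : Module.finrank F H = N + M) (hh : Module.finrank F h = M) (i : ℕ) :
    proj h i ∈ incAlg h N M := by
  by_cases hi : N < i
  · rw [proj_eq_zero hH hh hi]
    exact zero_mem _
  have hinj : Set.InjOn (kEigenvalue F N M) (Finset.range (N + 1)) := by
    intro a ha b hb hab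
    have := card_field_pow_injective F hab
    simp only [Finset.coe_range, Set.mem_Iio] at ha hb
    omega
  have key : proj h i = Polynomial.aeval (diagK h N M)
      (Lagrange.basis (Finset.range (N + 1)) (kEigenvalue F N M) i) := by
    have h1 : diagK h N M = Matrix.diagonalAlgHom ℂ
        fun x : AttenuatedSpace h => kEigenvalue F N M x.rank := diagK_eq_diagonal hH hh
    rw [h1, Polynomial.aeval_algHom_apply, proj, Matrix.diagonalAlgHom_apply]
    congr 1
    funext x
    have h2 := Polynomial.aeval_algHom_apply (Pi.evalAlgHom ℂ (fun _ : AttenuatedSpace h => ℂ) x)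
      (fun x : AttenuatedSpace h => kEigenvalue F N M x.rank)
      (Lagrange.basis (Finset.range (N + 1)) (kEigenvalue F N M) i)
    simp only [Pi.evalAlgHom_apply] at h2
    rw [← h2, Polynomial.coe_aeval_eq_eval]
    have h3 := rank_le hH hh x
    split_ifs with hx
    · rw [hx, Lagrange.eval_basis_self hinj (by simp; omega)]
    · rw [Lagrange.eval_basis_of_ne (Ne.symm hx) (by simp; omega)]
  rw [key]
  exact Algebra.adjoin_mono (by simp) (Polynomial.aeval_mem_adjoin_singleton ℂ _)

/-! ### Two central elements -/

lemma commute_of_mem_incAlg (hH : Module.finrank F H = N + M) (hh : Module.finrank F h = M)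
    {A B : Mat h} (hR : Commute A (raising h)) (hL : Commute A (lowering h))
    (hK : Commute A (diagK h N M)) (hB : B ∈ incAlg h N M) : Commute A B := by
  have hK' : Commute A (diagK h N M)⁻¹ := by
    have h1 := congrArg (fun X => (diagK h N M)⁻¹ * X * (diagK h N M)⁻¹) hK.eq
    simp only [mul_assoc, diagK_mul_inv hH hh, mul_one] at h1
    rw [← mul_assoc _ (diagK h N M), diagK_inv_mul hH hh, one_mul] at h1
    exact h1.symm
  have hle : incAlg h N M ≤ Subalgebra.centralizer ℂ {A} := by
    refine Algebra.adjoin_le ?_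
    rintro X (rfl | rfl | rfl | rfl) <;>
      simpa only [SetLike.mem_coe, Subalgebra.mem_centralizer_iff, Set.mem_singleton_iff,
        forall_eq]
  exact (Subalgebra.mem_centralizer_iff ℂ).1 (hle hB) A rfl

/-- An element of `T` that commutes with the generators, as an element of the center of `T`. -/
def toCenter (hH : Module.finrank F H = N + M) (hh : Module.finrank F h = M)
    (A : Mat h) (hA : A ∈ incAlg h N M) (hR : Commute A (raising h)) (hL : Commute A (lowering h))
    (hK : Commute A (diagK h N M)) : Subalgebra.center ℂ (incAlg h N M) :=
  ⟨⟨A, hA⟩, Subalgebra.mem_center_iff.2 fun B =>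
    Subtype.ext (commute_of_mem_incAlg hH hh hR hL hK B.2).symm.eq⟩

variable (h N M) in
/-- The difference `K - (q - 1)(LR - RL)`, which equals `C K⁻¹` for the scaled sum of shears
`C = q^M S`. -/
noncomputable def defect : Mat h :=
  diagK h N M - ((Nat.card F : ℂ) - 1) • (lowering h * raising h - raising h * lowering h)

lemma defect_mul_diagK (hH : Module.finrank F H = N + M) (hh : Module.finrank F h = M) :
    defect h N M * diagK h N M = (Nat.card F : ℂ) ^ M • shearSum h := by
  rw [defect, sub_mul, smul_mul_assoc, commutator_mul_diagK hH hh, sub_sub_cancel]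

lemma defect_mem : defect h N M ∈ incAlg h N M :=
  sub_mem diagK_mem (Subalgebra.smul_mem _ (sub_mem (mul_mem lowering_mem raising_mem)
    (mul_mem raising_mem lowering_mem)) _)

/-- The sum of all shears, scaled by `q^M`, as a central element of `T`. -/
noncomputable def shearElement (hH : Module.finrank F H = N + M) (hh : Module.finrank F h = M) :
    Subalgebra.center ℂ (incAlg h N M) :=
  toCenter hH hh ((Nat.card F : ℂ) ^ M • shearSum h)
    (by
      rw [← defect_mul_diagK hH hh]
      exact mul_mem defect_mem diagK_mem)
    (Commute.smul_left raising_commute_shearSum.symm _)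
    (Commute.smul_left lowering_commute_shearSum.symm _)
    (by
      rw [diagK_eq_diagonal hH hh]
      exact Commute.smul_left (diagonal_rank_commute_shearSum _).symm _)

lemma coe_shearElement (hH : Module.finrank F H = N + M) (hh : Module.finrank F h = M) :
    ((shearElement hH hh : incAlg h N M) : Mat h) = defect h N M * diagK h N M :=
  (defect_mul_diagK hH hh).symm

lemma commute_center (z : Subalgebra.center ℂ (incAlg h N M)) {A : Mat h}
    (hA : A ∈ incAlg h N M) : Commute ((z : incAlg h N M) : Mat h) A :=
  (congrArg Subtype.val (Subalgebra.mem_center_iff.1 z.2 ⟨A, hA⟩)).symm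

lemma lowering_mul_defect (hH : Module.finrank F H = N + M) (hh : Module.finrank F h = M) :
    lowering h * defect h N M = (Nat.card F : ℂ) • (defect h N M * lowering h) := by
  have h1 := (commute_center (shearElement hH hh) lowering_mem).eq
  rw [coe_shearElement] at h1
  have h2 : lowering h * defect h N M =
      lowering h * (defect h N M * diagK h N M) * (diagK h N M)⁻¹ := by
    rw [mul_assoc, mul_assoc, diagK_mul_inv hH hh, mul_one]
  rw [h2, ← h1, mul_assoc (defect h N M), diagK_mul_lowering hH hh, mul_smul_comm, smul_mul_assoc,
    mul_assoc, mul_assoc, diagK_mul_inv hH hh, mul_one]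

variable (h N M) in
/-- The Casimir matrix `(q - 1)² RL + q K + C K⁻¹`, where `C K⁻¹ = K - (q - 1)(LR - RL)`. -/
noncomputable def casimir : Mat h :=
  ((Nat.card F : ℂ) - 1) ^ 2 • (raising h * lowering h) + (Nat.card F : ℂ) • diagK h N M +
    defect h N M

lemma casimir_mul_lowering (hH : Module.finrank F H = N + M) (hh : Module.finrank F h = M) :
    casimir h N M * lowering h = lowering h * casimir h N M := by
  have h1 := diagK_mul_lowering hH hh
  have h2 := lowering_mul_defect hH hh
  have h3 : defect h N M * lowering h = diagK h N M * lowering h - ((Nat.card F : ℂ) - 1) •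
      (lowering h * (raising h * lowering h) - raising h * lowering h * lowering h) := by
    rw [defect, sub_mul, smul_mul_assoc, sub_mul, mul_assoc (lowering h)]
  rw [casimir, add_mul, add_mul, mul_add, mul_add, h2, smul_mul_assoc, smul_mul_assoc,
    mul_smul_comm, mul_smul_comm, ← h1, h3]
  module

lemma casimir_mul_diagK (hH : Module.finrank F H = N + M) (hh : Module.finrank F h = M) :
    casimir h N M * diagK h N M = diagK h N M * casimir h N M := by
  have hRL : raising h * lowering h * diagK h N M = diagK h N M * (raising h * lowering h) := by
    have h1 := congrArg (raising h * ·) (diagK_mul_lowering hH hh)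
    have h2 := congrArg (· * lowering h) (raising_mul_diagK hH hh)
    simp only [mul_smul_comm, smul_mul_assoc, ← mul_assoc] at h1 h2
    rw [h2] at h1
    rw [← mul_assoc]
    exact (smul_right_injective _ (card_field_ne_zero F) h1).symm
  have hD : defect h N M * diagK h N M = diagK h N M * defect h N M := by
    have h1 := (commute_center (shearElement hH hh) (diagK_mem (N := N) (M := M))).eq
    rw [coe_shearElement] at h1
    have h2 := congrArg (· * (diagK h N M)⁻¹) h1
    simpa only [mul_assoc, diagK_mul_inv hH hh, mul_one] using h2
  rw [casimir, add_mul, add_mul, mul_add, mul_add, hD, smul_mul_assoc, smul_mul_assoc,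
    mul_smul_comm, mul_smul_comm, hRL]

lemma casimir_transpose (hH : Module.finrank F H = N + M) (hh : Module.finrank F h = M) :
    (casimir h N M).transpose = casimir h N M := by
  rw [casimir, defect, diagK_eq_diagonal hH hh]
  simp [raising_eq_transpose, Matrix.transpose_mul]

lemma casimir_mul_raising (hH : Module.finrank F H = N + M) (hh : Module.finrank F h = M) :
    casimir h N M * raising h = raising h * casimir h N M := by
  have := congrArg Matrix.transpose (casimir_mul_lowering hH hh)
  rwa [Matrix.transpose_mul, Matrix.transpose_mul, casimir_transpose hH hh, ← raising_eq_transpose,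
    eq_comm] at this

/-- The Casimir matrix as a central element of `T`. -/
noncomputable def casimirElement (hH : Module.finrank F H = N + M)
    (hh : Module.finrank F h = M) : Subalgebra.center ℂ (incAlg h N M) :=
  toCenter hH hh (casimir h N M)
    (add_mem (add_mem (Subalgebra.smul_mem _ (mul_mem raising_mem lowering_mem) _)
      (Subalgebra.smul_mem _ diagK_mem _)) defect_mem)
    (casimir_mul_raising hH hh) (casimir_mul_lowering hH hh) (casimir_mul_diagK hH hh)

lemma coe_casimirElement (hH : Module.finrank F H = N + M) (hh : Module.finrank F h = M) :
    ((casimirElement hH hh : incAlg h N M) : Mat h) = casimir h N M := rfl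

end

end AttenuatedSpace

namespace AttenuatedSpace

section

variable {F H : Type*} [Field F] [AddCommGroup H] [Module F H] {h : Submodule F H}
  {N M : ℕ}

/-! ### Submodules and semisimplicity -/

lemma conjTranspose_raising : (raising h).conjTranspose = lowering h := by
  classical
  ext x y
  simp [raising, lowering, Matrix.conjTranspose_apply, apply_ite]

variable [Module.Finite F H] [Finite F]

lemma smul_mem_of_mem_incAlg (W : Submodule (incAlg h N M) (CP h)) {A : Mat h}
    (hA : A ∈ incAlg h N M) {w : CP h} (hw : w ∈ W) : A • w ∈ W :=
  W.smul_mem ⟨A, hA⟩ hw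

lemma complex_smul_mem (W : Submodule (incAlg h N M) (CP h)) (c : ℂ) {w : CP h} (hw : w ∈ W) :
    c • w ∈ W := by
  have h1 := smul_mem_of_mem_incAlg W ((incAlg h N M).algebraMap_mem c) hw
  rwa [Algebra.algebraMap_eq_smul_one, smul_assoc, one_smul] at h1

/-- A complex subspace that is stable under the generators of `T`, as a `T`-submodule. -/
def submoduleOfStable (V : Submodule ℂ (CP h)) (hR : ∀ v ∈ V, raising h • v ∈ V)
    (hL : ∀ v ∈ V, lowering h • v ∈ V) (hK : ∀ v ∈ V, diagK h N M • v ∈ V)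
    (hK' : ∀ v ∈ V, (diagK h N M)⁻¹ • v ∈ V) : Submodule (incAlg h N M) (CP h) where
  carrier := V
  add_mem' := V.add_mem
  zero_mem' := V.zero_mem
  smul_mem' := by
    rintro ⟨A, hA⟩ v hv
    change A • v ∈ V
    induction hA using Algebra.adjoin_induction generalizing v with
    | mem X hX =>
      rcases hX with rfl | rfl | rfl | rfl
      exacts [hR v hv, hL v hv, hK v hv, hK' v hv]
    | algebraMap c =>
      rw [Algebra.algebraMap_eq_smul_one, smul_assoc, one_smul]
      exact V.smul_mem c hv
    | add A B _ _ hA hB =>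
      rw [add_smul]
      exact V.add_mem (hA hv) (hB hv)
    | mul A B _ _ hA hB =>
      rw [mul_smul]
      exact hA (hB hv)

lemma conjTranspose_mem (hH : Module.finrank F H = N + M) (hh : Module.finrank F h = M)
    {A : Mat h} (hA : A ∈ incAlg h N M) : A.conjTranspose ∈ incAlg h N M := by
  have hK : (diagK h N M).conjTranspose = diagK h N M := by
    rw [diagK_eq_diagonal hH hh, Matrix.diagonal_conjTranspose]
    congr 1
    funext x
    simp [kEigenvalue]
  induction hA using Algebra.adjoin_induction with
  | mem X hX =>
    rcases hX with rfl | rfl | rfl | rfl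
    · rw [conjTranspose_raising]
      exact lowering_mem
    · rw [← conjTranspose_raising, Matrix.conjTranspose_conjTranspose]
      exact raising_mem
    · rw [hK]
      exact diagK_mem
    · rw [Matrix.conjTranspose_nonsing_inv, hK]
      exact diagK_inv_mem
  | algebraMap c =>
    rw [Algebra.algebraMap_eq_smul_one, Matrix.conjTranspose_smul, Matrix.conjTranspose_one]
    exact Subalgebra.smul_mem _ (one_mem _) _
  | add A B _ _ hA hB =>
    rw [Matrix.conjTranspose_add]
    exact add_mem hA hB
  | mul A B _ _ hA hB =>
    rw [Matrix.conjTranspose_mul]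
    exact mul_mem hB hA

open scoped ComplexOrder in
/-- The orthogonal complement of a `T`-submodule is a `T`-submodule since `T` is closed under
conjugate transposition. -/
lemma isSemisimpleModule_CP (hH : Module.finrank F H = N + M) (hh : Module.finrank F h = M) :
    IsSemisimpleModule (incAlg h N M) (CP h) := by
  refine { exists_isCompl := fun W => ?_ }
  let V : Submodule (incAlg h N M) (CP h) :=
    { carrier := {v | ∀ w ∈ W, star w ⬝ᵥ v = 0}
      add_mem' := fun {a b} ha hb w hw => by rw [dotProduct_add, ha w hw, hb w hw, add_zero]
      zero_mem' := fun w _ => dotProduct_zero _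
      smul_mem' := by
        rintro ⟨A, hA⟩ v hv w hw
        change star w ⬝ᵥ (A.mulVec v) = 0
        have h1 := hv _ (smul_mem_of_mem_incAlg W (conjTranspose_mem hH hh hA) hw)
        rwa [Matrix.smul_eq_mulVec, Matrix.star_mulVec, Matrix.conjTranspose_conjTranspose,
          ← Matrix.dotProduct_mulVec] at h1 }
  refine ⟨V, isCompl_iff.2 ⟨?_, ?_⟩⟩
  · rw [Submodule.disjoint_def]
    exact fun w hw hv => dotProduct_star_self_eq_zero.1 (hv w hw)
  · rw [codisjoint_iff, eq_top_iff]
    intro v _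
    let U : Submodule ℂ (EuclideanSpace ℂ (AttenuatedSpace h)) :=
      { carrier := {u | u.ofLp ∈ W}
        add_mem' := fun ha hb => W.add_mem ha hb
        zero_mem' := W.zero_mem
        smul_mem' := fun c _ hu => complex_smul_mem W c hu }
    obtain ⟨y, hy, z, hz, hyz⟩ := U.exists_add_mem_mem_orthogonal (WithLp.toLp 2 v)
    have h1 : v = y.ofLp + z.ofLp := congrArg WithLp.ofLp hyz
    rw [h1]
    refine Submodule.add_mem_sup hy fun w hw => ?_
    have h2 := (Submodule.mem_orthogonal _ _).1 hz (WithLp.toLp 2 w) hw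
    rw [EuclideanSpace.inner_eq_star_dotProduct, dotProduct_comm] at h2
    exact h2

/-- The vectors in simple `T`-submodules span `ℂP`. -/
lemma induction_on_simple (hH : Module.finrank F H = N + M) (hh : Module.finrank F h = M)
    {p : CP h → Prop}
    (hp : ∀ W : Submodule (incAlg h N M) (CP h), IsSimpleModule (incAlg h N M) W → ∀ w ∈ W, p w)
    (h0 : p 0) (hadd : ∀ v w, p v → p w → p (v + w)) (v : CP h) : p v := by
  have := isSemisimpleModule_CP (N := N) (M := M) hH hh
  have hv : v ∈ sSup {W : Submodule (incAlg h N M) (CP h) | IsSimpleModule (incAlg h N M) W} := by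
    rw [IsSemisimpleModule.sSup_simples_eq_top]
    exact Submodule.mem_top
  rw [sSup_eq_iSup'] at hv
  exact Submodule.iSup_induction _ (motive := p) hv (fun W w hw => hp W.1 W.2 w hw) h0 hadd

lemma eq_of_forall_simple (hH : Module.finrank F H = N + M) (hh : Module.finrank F h = M)
    {A B : Mat h} (hAB : ∀ W : Submodule (incAlg h N M) (CP h),
      IsSimpleModule (incAlg h N M) W → ∀ w ∈ W, A • w = B • w) : A = B :=
  Matrix.ext_iff_smul.2 <| induction_on_simple hH hh hAB (by rw [smul_zero, smul_zero])
    fun v w hv hw => by rw [smul_add, smul_add, hv, hw]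

/-! ### Simple modules -/

/-- Schur's lemma. -/
lemma exists_scalar (z : Subalgebra.center ℂ (incAlg h N M))
    (W : Submodule (incAlg h N M) (CP h)) [IsSimpleModule (incAlg h N M) W] :
    ∃ c : ℂ, ∀ w ∈ W, ((z : incAlg h N M) : Mat h) • w = c • w := by
  let f : Module.End (incAlg h N M) W :=
    { toFun := fun w => ⟨z.1 • w.1, W.smul_mem _ w.2⟩
      map_add' := fun v w => Subtype.ext (smul_add _ _ _)
      map_smul' := fun a w => Subtype.ext <| by
        change z.1 • a • w.1 = a • z.1 • w.1
        rw [← mul_smul, ← mul_smul, Subalgebra.mem_center_iff.1 z.2 a] }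
  have hfin : FiniteDimensional ℂ W :=
    FiniteDimensional.of_injective ((W.subtype).restrictScalars ℂ) W.injective_subtype
  obtain ⟨c, hc⟩ := (IsSimpleModule.algebraMap_end_bijective_of_isAlgClosed
    (A := incAlg h N M) (V := W) ℂ).2 f
  exact ⟨c, fun w hw => (congrArg Subtype.val (LinearMap.congr_fun hc ⟨w, hw⟩)).symm⟩

lemma eq_of_le_of_isSimpleModule {V W : Submodule (incAlg h N M) (CP h)}
    (hW : IsSimpleModule (incAlg h N M) W) (hVW : V ≤ W) {v : CP h} (hv : v ∈ V) (hv0 : v ≠ 0) :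
    V = W :=
  ((isSimpleModule_iff_isAtom.1 hW).le_iff.1 hVW).resolve_left fun hV => hv0 (by
    rwa [hV, Submodule.mem_bot] at hv)

lemma proj_smul_eq_zero (hH : Module.finrank F H = N + M) (hh : Module.finrank F h = M)
    {W : Submodule (incAlg h N M) (CP h)} {i : ℕ} (hi : i ∉ support W) {w : CP h} (hw : w ∈ W) :
    proj h i • w = 0 := by
  by_contra hne
  refine hi ⟨?_, w, hw, hne⟩
  by_contra hN
  rw [proj_eq_zero hH hh (not_le.1 hN), zero_smul] at hne
  exact hne rfl

lemma support_nonempty (hH : Module.finrank F H = N + M) (hh : Module.finrank F h = M)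
    {W : Submodule (incAlg h N M) (CP h)} (hW : IsSimpleModule (incAlg h N M) W) :
    (support W).Nonempty := by
  obtain ⟨w, hw, hw0⟩ := W.ne_bot_iff.1 (isSimpleModule_iff_isAtom.1 hW).1
  by_contra hemp
  rw [Set.not_nonempty_iff_eq_empty] at hemp
  refine hw0 ?_
  rw [← one_smul (Mat h) w, ← sum_proj hH hh, Finset.sum_smul]
  exact Finset.sum_eq_zero fun i _ => proj_smul_eq_zero hH hh (by simp [hemp]) hw

lemma exists_homogeneous (hH : Module.finrank F H = N + M) (hh : Module.finrank F h = M)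
    {W : Submodule (incAlg h N M) (CP h)} {i : ℕ} (hi : i ∈ support W) :
    ∃ w ∈ W, w ≠ 0 ∧ proj h i • w = w := by
  obtain ⟨-, w, hw, hw0⟩ := hi
  exact ⟨_, smul_mem_of_mem_incAlg W (proj_mem hH hh i) hw, hw0, by
    rw [← mul_smul, proj_mul_self]⟩

/-- If `i` is not in the support of `W`, then the vectors of `W` supported on ranks below `i` form
a submodule, so a simple `W` has no gaps in its support. -/
lemma support_ordConnected (hH : Module.finrank F H = N + M) (hh : Module.finrank F h = M)
    {W : Submodule (incAlg h N M) (CP h)} (hW : IsSimpleModule (incAlg h N M) W) :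
    (support W).OrdConnected := by
  rw [Set.ordConnected_def]
  rintro r hr s hs i ⟨hri, his⟩
  by_contra hi
  obtain ⟨w, hw, hw0, hwr⟩ := exists_homogeneous hH hh hr
  obtain ⟨v, hv, hv0, hvs⟩ := exists_homogeneous hH hh hs
  let V : Submodule ℂ (CP h) :=
    { carrier := {u | u ∈ W ∧ ∀ j, i ≤ j → proj h j • u = 0}
      add_mem' := fun ha hb => ⟨W.add_mem ha.1 hb.1, fun j hj => by
        rw [smul_add, ha.2 j hj, hb.2 j hj, add_zero]⟩
      zero_mem' := ⟨W.zero_mem, fun j _ => smul_zero _⟩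
      smul_mem' := fun c u hu => ⟨complex_smul_mem W c hu.1, fun j hj => by
        rw [smul_comm, hu.2 j hj, smul_zero]⟩ }
  let V' : Submodule (incAlg h N M) (CP h) := submoduleOfStable V
    (fun u hu => ⟨smul_mem_of_mem_incAlg W raising_mem hu.1, fun j hj => by
      rcases hj.eq_or_lt with rfl | hj
      · exact proj_smul_eq_zero hH hh hi (smul_mem_of_mem_incAlg W raising_mem hu.1)
      · obtain ⟨j, rfl⟩ := Nat.exists_eq_succ_of_ne_zero (Nat.ne_zero_of_lt hj)
        rw [← mul_smul, proj_mul_raising, mul_smul, hu.2 j (by omega), smul_zero]⟩)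
    (fun u hu => ⟨smul_mem_of_mem_incAlg W lowering_mem hu.1, fun j hj => by
      rw [← mul_smul, proj_mul_lowering, mul_smul, hu.2 (j + 1) (by omega), smul_zero]⟩)
    (fun u hu => ⟨smul_mem_of_mem_incAlg W diagK_mem hu.1, fun j hj => by
      rw [← mul_smul, proj_mul_diagK hH hh, mul_smul, hu.2 j hj, smul_zero]⟩)
    (fun u hu => ⟨smul_mem_of_mem_incAlg W diagK_inv_mem hu.1, fun j hj => by
      rw [← mul_smul, proj_mul_diagK_inv hH hh, mul_smul, hu.2 j hj, smul_zero]⟩)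
  have hwV : w ∈ V' := ⟨hw, fun j hj => by
    have hjr : j ≠ r := by
      rintro rfl
      exact hi (le_antisymm hj hri ▸ hr)
    rw [← hwr, ← mul_smul, proj_mul_of_ne hjr, zero_smul]⟩
  have hVW : V' = W := eq_of_le_of_isSimpleModule hW (fun u hu => hu.1) hwV hw0
  have hvV : v ∈ V' := hVW ▸ hv
  exact hv0 (hvs ▸ hvV.2 s his)

lemma support_bddAbove (W : Submodule (incAlg h N M) (CP h)) : BddAbove (support W) :=
  ⟨N, fun _ hi => hi.1⟩

/-- The support of a simple module is the interval from its endpoint `r` to `r + d`, where `d` is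
its diameter. -/
lemma support_eq_Icc (hH : Module.finrank F H = N + M) (hh : Module.finrank F h = M)
    {W : Submodule (incAlg h N M) (CP h)} (hW : IsSimpleModule (incAlg h N M) W) :
    support W = Set.Icc (endpoint W) (endpoint W + diameter W) := by
  have hne := support_nonempty hH hh hW
  have hle : sInf (support W) ≤ sSup (support W) :=
    Nat.sInf_le (Nat.sSup_mem hne (support_bddAbove W))
  have h1 : support W = Set.Icc (sInf (support W)) (sSup (support W)) :=
    Set.Subset.antisymm
      (fun i hi => ⟨Nat.sInf_le hi, le_csSup (support_bddAbove W) hi⟩)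
      ((support_ordConnected hH hh hW).out (Nat.sInf_mem hne)
        (Nat.sSup_mem hne (support_bddAbove W)))
  have h2 : endpoint W + diameter W = sSup (support W) := by
    have h3 : (support W).ncard = sSup (support W) + 1 - sInf (support W) := by
      conv_lhs => rw [h1]
      rw [Set.ncard_eq_toFinset_card', Set.toFinset_Icc, Nat.card_Icc]
    rw [diameter, h3, endpoint]
    omega
  rw [h2]
  exact h1

lemma endpoint_add_diameter_le (hH : Module.finrank F H = N + M) (hh : Module.finrank F h = M)
    {W : Submodule (incAlg h N M) (CP h)} (hW : IsSimpleModule (incAlg h N M) W) :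
    endpoint W + diameter W ≤ N := by
  have h1 : endpoint W + diameter W ∈ support W := by
    rw [support_eq_Icc hH hh hW]
    simp
  exact h1.1

lemma diagK_smul_of_proj_smul (hH : Module.finrank F H = N + M) (hh : Module.finrank F h = M)
    {i : ℕ} {w : CP h} (hw : proj h i • w = w) :
    diagK h N M • w = kEigenvalue F N M i • w := by
  rw [← hw, ← mul_smul, diagK_mul_proj hH hh, smul_assoc]

/-- On a simple module of endpoint `r` and diameter `d`, the scaled sum of shears and the Casimir
matrix act as `κ_r κ_{r+d}` and `q κ_r + κ_{r+d}`, where `κ_i` is the eigenvalue of `K` on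
rank `i`. -/
theorem central_scalars (hH : Module.finrank F H = N + M) (hh : Module.finrank F h = M)
    {W : Submodule (incAlg h N M) (CP h)} (hW : IsSimpleModule (incAlg h N M) W) :
    (∀ w ∈ W, ((shearElement hH hh : incAlg h N M) : Mat h) • w =
      (kEigenvalue F N M (endpoint W) * kEigenvalue F N M (endpoint W + diameter W)) • w) ∧
    ∀ w ∈ W, ((casimirElement hH hh : incAlg h N M) : Mat h) • w =
      (Nat.card F * kEigenvalue F N M (endpoint W) +
        kEigenvalue F N M (endpoint W + diameter W)) • w := by
  obtain ⟨c, hc⟩ := exists_scalar (shearElement hH hh) W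
  obtain ⟨s, hs⟩ := exists_scalar (casimirElement hH hh) W
  have hsupp := support_eq_Icc hH hh hW
  set r := endpoint W
  set t := endpoint W + diameter W with ht
  have hrt : r ≤ t := Nat.le_add_right _ _
  set a := kEigenvalue F N M r
  set b := kEigenvalue F N M t
  have ha0 : a ≠ 0 := kEigenvalue_ne_zero F N M r
  have hb0 : b ≠ 0 := kEigenvalue_ne_zero F N M t
  have htN : t ≤ N := endpoint_add_diameter_le hH hh hW
  -- On vectors of rank `i`, `defect = C K⁻¹` acts as `c / κ_i`.
  have hdefect : ∀ {i : ℕ} {w : CP h}, w ∈ W → proj h i • w = w →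
      defect h N M • w = (c / kEigenvalue F N M i) • w := by
    intro i w hw hi
    have h1 := hc w hw
    rw [coe_shearElement, mul_smul, diagK_smul_of_proj_smul hH hh hi, smul_comm] at h1
    rw [div_eq_inv_mul, mul_smul, ← h1, smul_smul, inv_mul_cancel₀ (kEigenvalue_ne_zero F N M i),
      one_smul]
  -- The lowest vectors are killed by `L`.
  have hbot : s = Nat.card F * a + c / a := by
    obtain ⟨w, hw, hw0, hwr⟩ := exists_homogeneous hH hh (W := W) (i := r)
      (by rw [hsupp]; exact ⟨le_rfl, hrt⟩)
    have hL : lowering h • w = 0 := by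
      rcases Nat.eq_zero_or_pos r with h0 | hpos
      · rw [← hwr, h0, ← mul_smul, lowering_mul_proj_zero, zero_smul]
      · obtain ⟨k, hk⟩ := Nat.exists_eq_succ_of_ne_zero hpos.ne'
        rw [← hwr, hk, ← mul_smul, Nat.succ_eq_add_one, ← proj_mul_lowering, mul_smul]
        refine proj_smul_eq_zero hH hh ?_ (smul_mem_of_mem_incAlg W lowering_mem hw)
        rw [hsupp, Set.mem_Icc]
        omega
    have h1 := hs w hw
    rw [coe_casimirElement, casimir, add_smul, add_smul, smul_assoc, mul_smul, hL, smul_zero,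
      smul_zero, zero_add, smul_assoc, diagK_smul_of_proj_smul hH hh hwr, hdefect hw hwr,
      smul_smul, ← add_smul] at h1
    exact (smul_left_injective ℂ hw0 h1).symm
  -- The highest vectors are killed by `R`.
  have htop : s = b + Nat.card F * (c / b) := by
    obtain ⟨w, hw, hw0, hwt⟩ := exists_homogeneous hH hh (W := W) (i := t)
      (by rw [hsupp]; exact ⟨hrt, le_rfl⟩)
    have hR : raising h • w = 0 := by
      rw [← hwt, ← mul_smul, ← proj_mul_raising, mul_smul]
      refine proj_smul_eq_zero hH hh ?_ (smul_mem_of_mem_incAlg W raising_mem hw)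
      rw [hsupp, Set.mem_Icc]
      omega
    have h1 := hs w hw
    have h2 := hdefect hw hwt
    have h3 := h2
    rw [defect, sub_smul _ (_ • _), smul_assoc, sub_smul (lowering h * _), mul_smul, hR, smul_zero,
      zero_sub, diagK_smul_of_proj_smul hH hh hwt] at h2
    rw [coe_casimirElement, casimir, add_smul, add_smul, smul_assoc, smul_assoc,
      diagK_smul_of_proj_smul hH hh hwt, h3] at h1
    generalize (raising h * lowering h) • w = u at h1 h2
    have h4 : (b + Nat.card F * (c / b)) • w = s • w := by
      have h5 : (c / b) • w =
          b • w + ((Nat.card F : ℂ) - 1) • u := by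
        rw [← h2]
        module
      calc (b + Nat.card F * (c / b)) • w
          = b • w + ((Nat.card F : ℂ) - 1) • (c / b) • w + (c / b) • w := by module
        _ = ((Nat.card F : ℂ) - 1) ^ 2 • u +
            (Nat.card F : ℂ) • b • w + (c / b) • w := by
          congr 1
          rw [h5]
          module
        _ = s • w := h1
    exact (smul_left_injective ℂ hw0 h4).symm
  have hne : (Nat.card F : ℂ) * a - b ≠ 0 := by
    intro h0
    have h1 : (Nat.card F : ℂ) ^ (N + M - r + 1) = (Nat.card F : ℂ) ^ (N + M - t) := by
      rw [pow_succ']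
      exact sub_eq_zero.1 h0
    have := card_field_pow_injective F h1
    omega
  have hcab : c = a * b := by
    have h1 : (Nat.card F : ℂ) * a + c / a = b + Nat.card F * (c / b) := hbot.symm.trans htop
    field_simp at h1
    refine mul_left_cancel₀ hne ?_
    linear_combination -h1
  refine ⟨fun w hw => by rw [hc w hw, hcab], fun w hw => ?_⟩
  rw [hs w hw, hbot, hcab, mul_div_cancel_left₀ _ ha0]

end

end AttenuatedSpace

namespace AttenuatedSpace

section

variable {F H : Type*} [Field F] [AddCommGroup H] [Module F H] {h : Submodule F H}
  [Module.Finite F H] [Finite F] {N M : ℕ}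

/-! ### The central idempotents -/

/-- A type `(r, d)` can be recovered from the scalars in `central_scalars`: these are, up to a power
of `q`, the product and the sum of `q κ_r` and `κ_{r+d}`, of which `q κ_r` is the larger. -/
lemma type_eq_of_scalars_eq {s t : ℕ × ℕ} (hs : s.1 + s.2 ≤ N) (ht : t.1 + t.2 ≤ N)
    (hmul : kEigenvalue F N M s.1 * kEigenvalue F N M (s.1 + s.2) =
      kEigenvalue F N M t.1 * kEigenvalue F N M (t.1 + t.2))
    (hadd : Nat.card F * kEigenvalue F N M s.1 + kEigenvalue F N M (s.1 + s.2) =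
      Nat.card F * kEigenvalue F N M t.1 + kEigenvalue F N M (t.1 + t.2)) : s = t := by
  have hroot : (Nat.card F * kEigenvalue F N M s.1 - Nat.card F * kEigenvalue F N M t.1) *
      (Nat.card F * kEigenvalue F N M s.1 - kEigenvalue F N M (t.1 + t.2)) = 0 := by
    linear_combination (Nat.card F * kEigenvalue F N M s.1) * hadd - Nat.card F * hmul
  rcases mul_eq_zero.1 hroot with h1 | h1
  · have h2 := sub_eq_zero.1 h1
    have h3 : kEigenvalue F N M (s.1 + s.2) = kEigenvalue F N M (t.1 + t.2) := by
      linear_combination hadd - h2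
    have h4 := card_field_pow_injective F h3
    have h5 := card_field_pow_injective F (mul_left_cancel₀ (card_field_ne_zero F) h2)
    ext <;> omega
  · have h2 := sub_eq_zero.1 h1
    have h3 : Nat.card F * kEigenvalue F N M t.1 = kEigenvalue F N M (s.1 + s.2) := by
      linear_combination h2 - hadd
    rw [kEigenvalue, kEigenvalue, ← pow_succ'] at h2 h3
    have h4 := card_field_pow_injective F h2
    have h5 := card_field_pow_injective F h3
    omega

variable (h N M) in
/-- The inclusion of the center of `T` in the matrix algebra. -/
noncomputable def centerVal : Subalgebra.center ℂ (incAlg h N M) →ₐ[ℂ] Mat h :=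
  (incAlg h N M).val.comp (Subalgebra.center ℂ (incAlg h N M)).val

/-- The type `(r, d)` of a `T`-module. -/
noncomputable def typeOf (W : Submodule (incAlg h N M) (CP h)) : ℕ × ℕ := (endpoint W, diameter W)

/-- The central element `z` acts on each simple `T`-module of type `t` as the scalar `f t`. -/
def ActsAs (z : Subalgebra.center ℂ (incAlg h N M)) (f : ℕ × ℕ → ℂ) : Prop :=
  ∀ W : Submodule (incAlg h N M) (CP h), IsSimpleModule (incAlg h N M) W →
    ∀ w ∈ W, centerVal h N M z • w = f (typeOf W) • w

lemma ActsAs.sub {y z : Subalgebra.center ℂ (incAlg h N M)} {f g : ℕ × ℕ → ℂ} (hy : ActsAs y f)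
    (hz : ActsAs z g) : ActsAs (y - z) (f - g) := fun W hW w hw => by
  have h1 : centerVal h N M (y - z) = centerVal h N M y - centerVal h N M z := rfl
  rw [h1, sub_smul, hy W hW w hw, hz W hW w hw, Pi.sub_apply, sub_smul]

lemma ActsAs.smul {z : Subalgebra.center ℂ (incAlg h N M)} {f : ℕ × ℕ → ℂ} (hz : ActsAs z f)
    (c : ℂ) : ActsAs (c • z) (c • f) := fun W hW w hw => by
  rw [map_smul, smul_assoc, hz W hW w hw, Pi.smul_apply, smul_assoc]

lemma ActsAs.mul {y z : Subalgebra.center ℂ (incAlg h N M)} {f g : ℕ × ℕ → ℂ} (hy : ActsAs y f)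
    (hz : ActsAs z g) : ActsAs (y * z) (f * g) := fun W hW w hw => by
  rw [map_mul, mul_smul, hz W hW w hw, smul_comm, hy W hW w hw, Pi.mul_apply, mul_comm, mul_smul]

lemma actsAs_one : ActsAs (1 : Subalgebra.center ℂ (incAlg h N M)) 1 := fun W _ w _ => by
  rw [map_one, one_smul, Pi.one_apply, one_smul]

lemma actsAs_prod {ι : Type*} (S : Finset ι) {z : ι → Subalgebra.center ℂ (incAlg h N M)}
    {f : ι → ℕ × ℕ → ℂ} (hz : ∀ i ∈ S, ActsAs (z i) (f i)) :
    ActsAs (∏ i ∈ S, z i) (∏ i ∈ S, f i) := by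
  classical
  induction S using Finset.induction_on with
  | empty => exact actsAs_one
  | insert i S hi ih =>
    rw [Finset.prod_insert hi, Finset.prod_insert hi]
    exact (hz i (Finset.mem_insert_self i S)).mul
      (ih fun j hj => hz j (Finset.mem_insert_of_mem hj))

lemma typeOf_mem_types (hH : Module.finrank F H = N + M) (hh : Module.finrank F h = M)
    {W : Submodule (incAlg h N M) (CP h)} (hW : IsSimpleModule (incAlg h N M) W) :
    typeOf W ∈ types h N M := by
  have := endpoint_add_diameter_le hH hh hW
  simp only [types, typeOf, Finset.mem_filter, Finset.mem_product, Finset.mem_range]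
  exact ⟨⟨by omega, by omega⟩, W, hW, rfl, rfl⟩

lemma add_le_of_mem_types (hH : Module.finrank F H = N + M) (hh : Module.finrank F h = M)
    {t : ℕ × ℕ} (ht : t ∈ types h N M) : t.1 + t.2 ≤ N := by
  simp only [types, Finset.mem_filter] at ht
  obtain ⟨-, W, hW, h1, h2⟩ := ht
  rw [← h1, ← h2]
  exact endpoint_add_diameter_le hH hh hW

lemma exists_separating (hH : Module.finrank F H = N + M) (hh : Module.finrank F h = M)
    {s t : ℕ × ℕ} (hs : s ∈ types h N M) (ht : t ∈ types h N M) (hst : s ≠ t) :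
    ∃ (z : Subalgebra.center ℂ (incAlg h N M)) (f : ℕ × ℕ → ℂ), ActsAs z f ∧ f t = 1 ∧ f s = 0 := by
  have key : ∀ (y : Subalgebra.center ℂ (incAlg h N M)) (g : ℕ × ℕ → ℂ), ActsAs y g → g s ≠ g t →
      ∃ (z : Subalgebra.center ℂ (incAlg h N M)) (f : ℕ × ℕ → ℂ),
        ActsAs z f ∧ f t = 1 ∧ f s = 0 := by
    intro y g hy hg
    refine ⟨_, _, (hy.sub (actsAs_one.smul (g s))).smul (g t - g s)⁻¹, ?_, ?_⟩
    · simp [inv_mul_cancel₀ (sub_ne_zero.2 hg.symm)]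
    · simp
  by_cases hmul : kEigenvalue F N M s.1 * kEigenvalue F N M (s.1 + s.2) =
      kEigenvalue F N M t.1 * kEigenvalue F N M (t.1 + t.2)
  · exact key (casimirElement hH hh)
      (fun t => Nat.card F * kEigenvalue F N M t.1 + kEigenvalue F N M (t.1 + t.2))
      (fun W hW w hw => (central_scalars hH hh hW).2 w hw) fun hadd =>
        hst (type_eq_of_scalars_eq (add_le_of_mem_types hH hh hs) (add_le_of_mem_types hH hh ht)
          hmul hadd)
  · exact key (shearElement hH hh)
      (fun t => kEigenvalue F N M t.1 * kEigenvalue F N M (t.1 + t.2))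
      (fun W hW w hw => (central_scalars hH hh hW).1 w hw) hmul

lemma exists_centerVal_indicator (hH : Module.finrank F H = N + M) (hh : Module.finrank F h = M)
    {t : ℕ × ℕ} (ht : t ∈ types h N M) :
    ∃ z : Subalgebra.center ℂ (incAlg h N M),
      ∀ W : Submodule (incAlg h N M) (CP h), IsSimpleModule (incAlg h N M) W →
        ∀ w ∈ W, centerVal h N M z • w = if typeOf W = t then w else 0 := by
  classical
  have hex : ∀ s, ∃ (z : Subalgebra.center ℂ (incAlg h N M)) (f : ℕ × ℕ → ℂ),
      s ∈ (types h N M).erase t → ActsAs z f ∧ f t = 1 ∧ f s = 0 := by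
    intro s
    by_cases hs : s ∈ (types h N M).erase t
    · obtain ⟨z, f, hzf⟩ :=
        exists_separating hH hh (Finset.mem_of_mem_erase hs) ht (Finset.ne_of_mem_erase hs)
      exact ⟨z, f, fun _ => hzf⟩
    · exact ⟨0, 0, fun h' => absurd h' hs⟩
  choose z f hzf using hex
  refine ⟨∏ s ∈ (types h N M).erase t, z s, fun W hW w hw => ?_⟩
  rw [actsAs_prod _ (fun s hs => (hzf s hs).1) W hW w hw, Finset.prod_apply]
  split_ifs with hWt
  · rw [hWt, Finset.prod_eq_one fun s hs => (hzf s hs).2.1, one_smul]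
  · rw [Finset.prod_eq_zero (i := typeOf W), zero_smul]
    · exact Finset.mem_erase.2 ⟨hWt, typeOf_mem_types hH hh hW⟩
    · exact (hzf _ (Finset.mem_erase.2 ⟨hWt, typeOf_mem_types hH hh hW⟩)).2.2

/-- The matrix `e_λ` is the central element of `T` that acts as the identity on simple modules of
type `λ` and as zero on the others; in particular `ℂP` is the direct sum of the `V_μ`. -/
lemma exists_centerVal_eq_centralIdem (hH : Module.finrank F H = N + M)
    (hh : Module.finrank F h = M) {t : ℕ × ℕ} (ht : t ∈ types h N M) :
    ∃ z : Subalgebra.center ℂ (incAlg h N M), centerVal h N M z = centralIdem h N M t ∧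
      ∀ W : Submodule (incAlg h N M) (CP h), IsSimpleModule (incAlg h N M) W →
        ∀ w ∈ W, centerVal h N M z • w = if typeOf W = t then w else 0 := by
  obtain ⟨z, hz⟩ := exists_centerVal_indicator hH hh ht
  refine ⟨z, ?_, hz⟩
  have hV : ∀ v ∈ homComponent h N M t, centerVal h N M z • v = v := by
    intro v hv
    induction hv using Submodule.span_induction with
    | mem v hv =>
      obtain ⟨W, ⟨hW, h1, h2⟩, hvW⟩ := hv
      rw [hz W hW v hvW, if_pos (Prod.ext h1 h2)]
    | zero => rw [smul_zero]
    | add v w _ _ hv hw => rw [smul_add, hv, hw]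
    | smul c v _ hv => rw [smul_comm, hv]
  have hV' : ∀ v ∈ homComponentCompl h N M t, centerVal h N M z • v = 0 := by
    have hle : homComponentCompl h N M t ≤
        LinearMap.ker (Matrix.mulVecLin (centerVal h N M z)) := by
      refine iSup₂_le fun s hs => Submodule.span_le.2 ?_
      rintro v ⟨W, ⟨hW, h1, h2⟩, hvW⟩
      refine (hz W hW v hvW).trans (if_neg fun hWt => Finset.ne_of_mem_erase hs ?_)
      rw [← hWt]
      exact (Prod.ext h1 h2).symm
    exact fun v hv => hle hv
  have hmem : ∀ W : Submodule (incAlg h N M) (CP h), IsSimpleModule (incAlg h N M) W → ∀ w ∈ W,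
      (typeOf W = t → w ∈ homComponent h N M t) ∧
        (typeOf W ≠ t → w ∈ homComponentCompl h N M t) := by
    refine fun W hW w hw => ⟨?_, fun hWt => ?_⟩
    · rintro rfl
      exact Submodule.subset_span ⟨W, ⟨hW, rfl, rfl⟩, hw⟩
    · have h1 : homComponent h N M (typeOf W) ≤ homComponentCompl h N M t :=
        le_iSup₂ (f := fun s _ => homComponent h N M s) (typeOf W)
          (Finset.mem_erase.2 ⟨hWt, typeOf_mem_types hH hh hW⟩)
      exact h1 (Submodule.subset_span ⟨W, ⟨hW, rfl, rfl⟩, hw⟩)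
  have hc : IsCompl (homComponent h N M t) (homComponentCompl h N M t) := by
    refine isCompl_iff.2 ⟨?_, ?_⟩
    · rw [Submodule.disjoint_def]
      exact fun v hv hv' => (hV v hv).symm.trans (hV' v hv')
    · rw [codisjoint_iff, eq_top_iff]
      refine fun v _ => induction_on_simple (N := N) hH hh
        (p := fun v => v ∈ homComponent h N M t ⊔ homComponentCompl h N M t)
        (fun W hW w hw => ?_) (zero_mem _) (fun v w => add_mem) v
      by_cases hWt : typeOf W = t
      · exact Submodule.mem_sup_left ((hmem W hW w hw).1 hWt)
      · exact Submodule.mem_sup_right ((hmem W hW w hw).2 hWt)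
  rw [centralIdem, dif_pos hc]
  refine eq_of_forall_simple hH hh fun W hW w hw => ?_
  rw [hz W hW w hw, Matrix.smul_eq_mulVec, LinearMap.toMatrix'_mulVec]
  split_ifs with hWt
  · exact (Submodule.projection_apply_of_mem_left hc ((hmem W hW w hw).1 hWt)).symm
  · exact ((Submodule.projection_apply_eq_zero_iff hc).2 ((hmem W hW w hw).2 hWt)).symm

/-- A linear combination of the `e_λ` is a central element of `T` that acts on simple modules of
type `λ` as the coefficient of `e_λ`. -/
lemma exists_actsAs (hH : Module.finrank F H = N + M) (hh : Module.finrank F h = M)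
    (f : ℕ × ℕ → ℂ) : ∃ z : Subalgebra.center ℂ (incAlg h N M),
      centerVal h N M z = ∑ t ∈ types h N M, f t • centralIdem h N M t ∧ ActsAs z f := by
  classical
  choose! z hz using fun t (ht : t ∈ types h N M) => exists_centerVal_eq_centralIdem hH hh ht
  refine ⟨∑ t ∈ types h N M, f t • z t, ?_, fun W hW w hw => ?_⟩
  · rw [map_sum]
    exact Finset.sum_congr rfl fun t ht => by rw [map_smul, (hz t ht).1]
  · rw [map_sum, Finset.sum_smul, Finset.sum_eq_single (typeOf W)]
    · rw [map_smul, smul_assoc, (hz _ (typeOf_mem_types hH hh hW)).2 W hW w hw, if_pos rfl]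
    · intro t ht hne
      rw [map_smul, smul_assoc, (hz t ht).2 W hW w hw, if_neg hne.symm, smul_zero]
    · exact fun hn => absurd (typeOf_mem_types hH hh hW) hn

lemma centerVal_eq_of_actsAs (hH : Module.finrank F H = N + M) (hh : Module.finrank F h = M)
    {y z : Subalgebra.center ℂ (incAlg h N M)} {f g : ℕ × ℕ → ℂ} (hy : ActsAs y f)
    (hz : ActsAs z g) (hfg : ∀ t ∈ types h N M, f t = g t) :
    centerVal h N M y = centerVal h N M z :=
  eq_of_forall_simple hH hh fun W hW w hw => by
    rw [hy W hW w hw, hz W hW w hw, hfg _ (typeOf_mem_types hH hh hW)]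

end

end AttenuatedSpace

/-! ### Modules over the quantum group -/

namespace UqSl2

section

variable {A : Type*} [Ring A] [Algebra ℂ A]

open UqSl2Gen in
/-- Elements of an algebra that satisfy the defining relations of `U_τ(sl₂)` define an algebra
homomorphism. -/
def lift (τ : ℂ) (x : UqSl2Gen → A) (h1 : x k * x kInv = 1) (h2 : x kInv * x k = 1)
    (h3 : x k * x e = τ ^ 2 • (x e * x k)) (h4 : x k * x f = (τ ^ 2)⁻¹ • (x f * x k))
    (h5 : x e * x f - x f * x e = (τ - τ⁻¹)⁻¹ • (x k - x kInv)) : UqSl2 τ →ₐ[ℂ] A :=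
  RingQuot.liftAlgHom ℂ ⟨FreeAlgebra.lift ℂ x, fun a b hab => by
    cases hab <;> simpa⟩

lemma lift_gen (τ : ℂ) (x : UqSl2Gen → A) (h1 h2 h3 h4 h5) (g : UqSl2Gen) :
    lift τ x h1 h2 h3 h4 h5 (gen τ g) = x g := by
  unfold lift gen
  exact (RingQuot.liftAlgHom_mkAlgHom_apply ℂ _ _ _).trans (FreeAlgebra.lift_ι_apply x g)

/-- Suppose that `[L, R] = (K - D) / (τ² - 1)` where `X D = c⁻² Y K⁻¹`, and that `X`, `Y = X⁻¹`
and `T` commute with all elements in question. Then `T L`, `τ c T⁻¹ X R` and `c X K` satisfy the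
relations of `U_τ(sl₂)`. -/
lemma exists_lift_of_central {τ c : ℂ} (hτ0 : τ ≠ 0) (hτ1 : τ ^ 2 - 1 ≠ 0) (hc : c ≠ 0)
    {L R K K' D X Y T T' : A} (hXL : Commute X L) (hXR : Commute X R) (hXK : Commute X K)
    (hYK : Commute Y K) (hXK' : Commute X K') (hTR : Commute T R)
    (hTK : Commute T K) (hTX : Commute T X) (hTL' : Commute T' L) (hTK' : Commute T' K)
    (hTX' : Commute T' X) (hTT' : T * T' = 1) (hTT : T' * T = 1) (hXY : X * Y = 1)
    (hYX : Y * X = 1) (hKK' : K * K' = 1) (hK'K : K' * K = 1)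
    (hKL : K * L = τ ^ 2 • (L * K)) (hRK : R * K = τ ^ 2 • (K * R))
    (hLR : (τ ^ 2 - 1) • (L * R - R * L) = K - D) (hXD : X * D = (c ^ 2)⁻¹ • (Y * K')) :
    ∃ φ : UqSl2 τ →ₐ[ℂ] A, φ (gen τ .e) = T * L ∧ φ (gen τ .f) = (τ * c) • (T' * X * R) ∧
      φ (gen τ .k) = c • (X * K) := by
  let x : UqSl2Gen → A
    | .e => T * L
    | .f => (τ * c) • (T' * X * R)
    | .k => c • (X * K)
    | .kInv => c⁻¹ • (Y * K')
  have h1 : x .k * x .kInv = 1 := by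
    change (c • (X * K)) * (c⁻¹ • (Y * K')) = 1
    rw [smul_mul_smul_comm, mul_inv_cancel₀ hc, one_smul, hYK.symm.mul_mul_mul_comm, hXY, hKK',
      one_mul]
  have h2 : x .kInv * x .k = 1 := by
    change (c⁻¹ • (Y * K')) * (c • (X * K)) = 1
    rw [smul_mul_smul_comm, inv_mul_cancel₀ hc, one_smul, hXK'.symm.mul_mul_mul_comm, hYX, hK'K,
      one_mul]
  have h3 : x .k * x .e = τ ^ 2 • (x .e * x .k) := by
    change (c • (X * K)) * (T * L) = τ ^ 2 • ((T * L) * (c • (X * K)))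
    rw [smul_mul_assoc, mul_smul_comm, hTK.symm.mul_mul_mul_comm, hXL.symm.mul_mul_mul_comm, hKL,
      mul_smul_comm, hTX.eq, smul_comm]
  have h4 : x .k * x .f = (τ ^ 2)⁻¹ • (x .f * x .k) := by
    change (c • (X * K)) * ((τ * c) • (T' * X * R)) =
      (τ ^ 2)⁻¹ • (((τ * c) • (T' * X * R)) * (c • (X * K)))
    rw [smul_mul_smul_comm, smul_mul_smul_comm, hXR.symm.mul_mul_mul_comm,
      (hTK'.mul_left hXK).symm.mul_mul_mul_comm, hRK, mul_smul_comm, smul_comm (τ ^ 2)⁻¹,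
      inv_smul_smul₀ (pow_ne_zero 2 hτ0), mul_comm c, ((hTX'.mul_left (Commute.refl X))).eq]
  have h5 : x .e * x .f - x .f * x .e = (τ - τ⁻¹)⁻¹ • (x .k - x .kInv) := by
    change (T * L) * ((τ * c) • (T' * X * R)) - ((τ * c) • (T' * X * R)) * (T * L) =
      (τ - τ⁻¹)⁻¹ • (c • (X * K) - c⁻¹ • (Y * K'))
    have e1 : T * L * (T' * X * R) = X * (L * R) := by
      rw [(hTL'.mul_left hXL).symm.mul_mul_mul_comm, ← mul_assoc T, hTT', one_mul]
    have e2 : T' * X * R * (T * L) = X * (R * L) := by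
      rw [hTR.symm.mul_mul_mul_comm, mul_assoc T', ← hTX.eq, ← mul_assoc T', hTT, one_mul]
    have e3 : (τ ^ 2 - 1) • (X * (L * R - R * L)) = X * K - (c ^ 2)⁻¹ • (Y * K') := by
      rw [← mul_smul_comm, hLR, mul_sub, hXD]
    have e4 : X * (L * R - R * L) = (τ ^ 2 - 1)⁻¹ • (X * K - (c ^ 2)⁻¹ • (Y * K')) := by
      rw [← e3, inv_smul_smul₀ hτ1]
    have e5 : τ - τ⁻¹ = (τ ^ 2 - 1) / τ := by field_simp
    rw [mul_smul_comm, smul_mul_assoc, e1, e2, ← smul_sub, ← mul_sub, e4, e5, smul_sub, smul_sub,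
      smul_sub, smul_smul, smul_smul, smul_smul, smul_smul, smul_smul]
    congr 2 <;> field_simp
  exact ⟨lift τ x h1 h2 h3 h4 h5, lift_gen .., lift_gen .., lift_gen ..⟩

end

end UqSl2

open AttenuatedSpace in
theorem mainTheorem4 {F H : Type*} [Field F] [Finite F] [AddCommGroup H] [Module F H]
    [Module.Finite F H] (N M : ℕ) (hN : 0 < N) (hM : 0 < M)
    (hH : Module.finrank F H = N + M) (h : Submodule F H) (hh : Module.finrank F h = M)
    (τ : ℂ) (hτ : τ ^ 2 = (Nat.card F : ℂ))
    (Θ : (Subalgebra.center ℂ (incAlg h N M))ˣ) :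
    Phi h N M ∈ (Subalgebra.center ℂ (incAlg h N M)).map (incAlg h N M).val ∧
    Omega h N M τ ∈ (Subalgebra.center ℂ (incAlg h N M)).map (incAlg h N M).val ∧
    (∀ W : Submodule (incAlg h N M) (CP h), IsSimpleModule (incAlg h N M) W → ∀ w ∈ W,
      Phi h N M • w = ((Nat.card F : ℂ) ^ endpoint W) • w ∧
      Omega h N M τ • w = (τ ^ diameter W) • w) ∧
    ∃ _ : Module (UqSl2 τ) (CP h), IsScalarTower ℂ (UqSl2 τ) (CP h) ∧
      ∀ v : CP h,
        UqSl2.gen τ .e • v = (((Θ : Subalgebra.center ℂ (incAlg h N M)) : incAlg h N M) : Mat h)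
          • lowering h • v ∧
        UqSl2.gen τ .f • v = (τ * (Nat.card F : ℂ) ^ (-(N : ℤ) - M)) •
          ((((Θ⁻¹ : (Subalgebra.center ℂ (incAlg h N M))ˣ) :
              Subalgebra.center ℂ (incAlg h N M)) : incAlg h N M) : Mat h)
            • Phi h N M • Omega h N M τ • raising h • v ∧
        UqSl2.gen τ .k • v = ((Nat.card F : ℂ) ^ (-(N : ℤ) - M)) •
          Phi h N M • Omega h N M τ • diagK h N M • v := by
  have hq0 : (Nat.card F : ℂ) ≠ 0 := card_field_ne_zero F
  have hτ0 : τ ≠ 0 := by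
    rintro rfl
    exact hq0 (by rw [← hτ]; simp)
  obtain ⟨φ, hφ, hφ'⟩ := exists_actsAs hH hh fun t => (Nat.card F : ℂ) ^ t.1
  obtain ⟨ω, hω, hω'⟩ := exists_actsAs hH hh fun t => τ ^ t.2
  obtain ⟨y, -, hy'⟩ := exists_actsAs hH hh fun t => ((Nat.card F : ℂ) ^ t.1 * τ ^ t.2)⁻¹
  have hPhi : Phi h N M = centerVal h N M φ := hφ.symm
  have hOmega : Omega h N M τ = centerVal h N M ω := hω.symm
  refine ⟨⟨φ, φ.2, hφ⟩, ⟨ω, ω.2, hω⟩, fun W hW w hw => ⟨?_, ?_⟩, ?_⟩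
  · rw [hPhi]
    exact hφ' W hW w hw
  · rw [hOmega]
    exact hω' W hW w hw
  set c : ℂ := (Nat.card F : ℂ) ^ (-(N : ℤ) - M) with hc
  have hc0 : c ≠ 0 := zpow_ne_zero _ hq0
  have hcn : c * (Nat.card F : ℂ) ^ (N + M) = 1 := by
    rw [hc, ← zpow_natCast, ← zpow_add₀ hq0]
    simp
  -- The inverse of `Φ Ω`, as an element of the center.
  have hxy : centerVal h N M (φ * ω) * centerVal h N M y = 1 := by
    rw [← map_mul, centerVal_eq_of_actsAs hH hh ((hφ'.mul hω').mul hy') actsAs_one, map_one]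
    intro t _
    simp only [Pi.mul_apply, Pi.one_apply]
    exact mul_inv_cancel₀ (mul_ne_zero (pow_ne_zero _ hq0) (pow_ne_zero _ hτ0))
  have hyx : centerVal h N M y * centerVal h N M (φ * ω) = 1 := by
    rw [← map_mul, mul_comm, map_mul, hxy]
  -- The sum of shears is a scalar multiple of `(Φ Ω)⁻²`.
  have hshear : centerVal h N M (shearElement hH hh) = (c ^ 2)⁻¹ • centerVal h N M (y * y) := by
    have hS : ActsAs (shearElement hH hh) fun t =>
        kEigenvalue F N M t.1 * kEigenvalue F N M (t.1 + t.2) :=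
      fun W hW w hw => (central_scalars hH hh hW).1 w hw
    rw [centerVal_eq_of_actsAs hH hh hS ((hy'.mul hy').smul (c ^ 2)⁻¹), map_smul]
    intro t ht
    obtain ⟨j, hj⟩ := Nat.exists_eq_add_of_le (add_le_of_mem_types hH hh ht)
    have e1 : N + M - t.1 = t.2 + j + M := by omega
    have e2 : N + M - (t.1 + t.2) = j + M := by omega
    have e3 : c⁻¹ = (Nat.card F : ℂ) ^ (t.1 + t.2 + j + M) := by
      rw [← hj]
      exact inv_eq_of_mul_eq_one_right hcn
    have e4 : (τ ^ t.2) * (τ ^ t.2) = (Nat.card F : ℂ) ^ t.2 := by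
      rw [← mul_pow, ← pow_two, hτ]
    simp only [kEigenvalue, Pi.mul_apply, Pi.smul_apply, smul_eq_mul]
    rw [e1, e2, ← inv_pow, e3, ← mul_inv, mul_mul_mul_comm _ (τ ^ t.2), e4, ← div_eq_mul_inv,
      eq_div_iff (mul_ne_zero (mul_ne_zero (pow_ne_zero _ hq0) (pow_ne_zero _ hq0))
        (pow_ne_zero _ hq0))]
    ring
  have hXD : centerVal h N M (φ * ω) * defect h N M =
      (c ^ 2)⁻¹ • (centerVal h N M y * (diagK h N M)⁻¹) := by
    have h1 : defect h N M = centerVal h N M (shearElement hH hh) * (diagK h N M)⁻¹ := by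
      change _ = ((shearElement hH hh : incAlg h N M) : Mat h) * _
      rw [coe_shearElement, mul_assoc, diagK_mul_inv hH hh, mul_one]
    rw [h1, hshear, map_mul _ y, smul_mul_assoc, mul_smul_comm, mul_assoc, ← mul_assoc,
      hxy, one_mul]
  have hΘ : centerVal h N M Θ *
      centerVal h N M (Θ⁻¹ : (Subalgebra.center ℂ (incAlg h N M))ˣ) = 1 := by
    rw [← map_mul, Units.mul_inv, map_one]
  have hΘ' : centerVal h N M (Θ⁻¹ : (Subalgebra.center ℂ (incAlg h N M))ˣ) *
      centerVal h N M Θ = 1 := by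
    rw [← map_mul, Units.inv_mul, map_one]
  have hcomm : ∀ (z : Subalgebra.center ℂ (incAlg h N M)) {A : Mat h}, A ∈ incAlg h N M →
      Commute (centerVal h N M z) A := fun z _ hA => commute_center z hA
  have hmem : ∀ z : Subalgebra.center ℂ (incAlg h N M), centerVal h N M z ∈ incAlg h N M :=
    fun z => z.1.2
  obtain ⟨ψ, he, hf, hk⟩ := UqSl2.exists_lift_of_central (τ := τ) (c := c) hτ0
    (by rw [hτ]; exact card_field_sub_one_ne_zero F) hc0
    (hcomm (φ * ω) lowering_mem) (hcomm (φ * ω) raising_mem) (hcomm (φ * ω) diagK_mem)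
    (hcomm y diagK_mem) (hcomm (φ * ω) diagK_inv_mem) (hcomm Θ raising_mem) (hcomm Θ diagK_mem)
    (hcomm Θ (hmem _)) (hcomm _ lowering_mem) (hcomm _ diagK_mem) (hcomm _ (hmem _)) hΘ hΘ' hxy hyx
    (diagK_mul_inv hH hh) (diagK_inv_mul hH hh) (by rw [hτ]; exact diagK_mul_lowering hH hh)
    (by rw [hτ]; exact raising_mul_diagK hH hh)
    (by rw [hτ]; exact (sub_sub_cancel _ _).symm) hXD
  let _ : Module (UqSl2 τ) (CP h) := Module.compHom (CP h) ψ.toRingHom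
  have hsmul : ∀ (a : UqSl2 τ) (v : CP h), a • v = ψ a • v := fun _ _ => rfl
  refine ⟨inferInstance, ⟨fun a u v => ?_⟩, fun v => ⟨?_, ?_, ?_⟩⟩
  · rw [hsmul, hsmul, map_smul, smul_assoc]
  · rw [hsmul, he, mul_smul]
    rfl
  · rw [hsmul, hf, smul_assoc, mul_assoc, map_mul, mul_assoc, ← hPhi, ← hOmega]
    simp only [mul_smul (_ : Mat h)]
    rfl
  · rw [hsmul, hk, smul_assoc, mul_smul, map_mul, mul_smul, ← hPhi, ← hOmega]
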